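/- Let $d\ge 3$, and let $\mathbb X\subset\mathbb R^d$ be a compact region, i.e. a compact set that is the closure of its connected, non-empty interior. Let $\boldsymbol X$ be a random vector in $\mathbb R^d$ with density $p$ such that $\operatorname{supp} p=\mathbb X$, $p$ is smooth on $\mathbb X$ and $p$ is strictly positive in the interior of $\mathbb X$. (Smoothness is only required on $\mathbb X$, so uniform densities are included.) Suppose that $p$ is rotationally symmetric about the $x_d$-axis, that is, $p(x_1,\dots,x_{d-1},x_d)=p(y_1,\dots,y_{d-1},x_d)$ whenever $\|(x_1,\dots,x_{d-1})\|=\|(y_1,\dots,y_{d-1})\|$. Let $\Gamma:[0,\ell]\to\mathbb X$, $\ell>0$, be an injective $C^\infty$ curve parameterized by arc-length. For $x\in\mathbb R^d$ let $$\lambda_\Gamma(x)=\sup\{s\in[0,\ell]:\|x-\Gamma(s)\|=\inf_{t\in[0,\ell]}\|x-\Gamma(t)\|\}.$$ Suppose that $\Gamma$ is a principal curve of $\boldsymbol X$, i.e. it is self-consistent: $\mathbb E[\boldsymbol X\mid\lambda_\Gamma(\boldsymbol X)]=\Gamma(\lambda_\Gamma(\boldsymbol X))$ almost surely. Suppose further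 that $\Gamma$ is admissible, i.e. (i) no point of $\mathbb X$ has two distinct closest points on $\Gamma$; (ii) for some smooth vector fields $N_1,\dots,N_{d-1}$ along $\Gamma$ such that $\Gamma'(s),N_1(s),\dots,N_{d-1}(s)$ is orthonormal for every $s\in[0,\ell]$, the normal coordinate map $\nu_\Gamma(s,u)=\Gamma(s)+\sum_{i=1}^{d-1}u_iN_i(s)$, restricted to the set of those $(s,u)\in[0,\ell]\times\mathbb R^{d-1}$ with $\nu_\Gamma(s,u)\in\mathbb X$, is a diffeomorphism onto its image. If $\Gamma(0)\in\partial\mathbb X$, then $\Gamma$ is contained in an (affine) hyperplane of $\mathbb R^d$. -/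

import Mathlib

open Set MeasureTheory
open scoped ContDiff

namespace PrincipalCurve

/-- A compact region: a compact set that is the closure of a domain (its connected,
non-empty interior). -/
structure IsCompactRegion {E : Type*} [TopologicalSpace E] (𝕏 : Set E) : Prop where
  isCompact : IsCompact 𝕏
  isConnected_interior : IsConnected (interior 𝕏)
  closure_interior : closure (interior 𝕏) = 𝕏

/-- `p` is a density with support `𝕏`, smooth on `𝕏` and strictly positive in the interior
of `𝕏`. Smoothness is only asked on `𝕏`, so that uniform densities are included. -/
structure IsSmoothDensityOn {n : ℕ} (p : EuclideanSpace ℝ (Fin (n + 1)) → ℝ)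
    (𝕏 : Set (EuclideanSpace ℝ (Fin (n + 1)))) : Prop where
  nonneg : ∀ x, 0 ≤ p x
  smooth : ContDiffOn ℝ ∞ p 𝕏
  support_eq : tsupport p = 𝕏
  pos : ∀ x ∈ interior 𝕏, 0 < p x

/-- The random vector `X` has the distribution with Lebesgue density `p`. -/
def HasDensity {Ω : Type*} [MeasurableSpace Ω] {n : ℕ} (P : Measure Ω)
    (X : Ω → EuclideanSpace ℝ (Fin (n + 1))) (p : EuclideanSpace ℝ (Fin (n + 1)) → ℝ) : Prop :=
  Measurable X ∧ P.map X = volume.withDensity (fun x => ENNReal.ofReal (p x))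

/-- Rotational symmetry about the last coordinate axis: `p x = p y` whenever `x` and `y` have
the same last coordinate and their remaining coordinates have the same Euclidean norm. -/
def RotationallySymmetric {n : ℕ} (p : EuclideanSpace ℝ (Fin (n + 1)) → ℝ) : Prop :=
  ∀ x y : EuclideanSpace ℝ (Fin (n + 1)), x (Fin.last n) = y (Fin.last n) →
    √(∑ i : Fin n, x i.castSucc ^ 2) = √(∑ i : Fin n, y i.castSucc ^ 2) → p x = p y

/-- The tangent `Γ'(s)` of a curve on `[0, ℓ]` (one-sided at the end points). -/
noncomputable def tangent {n : ℕ} (Γ : ℝ → EuclideanSpace ℝ (Fin (n + 1))) (ℓ s : ℝ) :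
    EuclideanSpace ℝ (Fin (n + 1)) :=
  derivWithin Γ (Icc 0 ℓ) s

/-- A smooth curve `Γ : [0, ℓ] → ℝᵈ` without self-intersections, parameterized by arc-length.
Only the values of `Γ` on `[0, ℓ]` matter. -/
structure IsSmoothJordanCurve {n : ℕ} (Γ : ℝ → EuclideanSpace ℝ (Fin (n + 1))) (ℓ : ℝ) :
    Prop where
  length_pos : 0 < ℓ
  smooth : ContDiffOn ℝ ∞ Γ (Icc 0 ℓ)
  injOn : InjOn Γ (Icc 0 ℓ)
  arcLength : ∀ s ∈ Icc 0 ℓ, ‖tangent Γ ℓ s‖ = 1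

/-- The projection index `λ_Γ(x)`: the largest parameter of a point of `Γ` closest to `x`. -/
noncomputable def projIndex {n : ℕ} (Γ : ℝ → EuclideanSpace ℝ (Fin (n + 1))) (ℓ : ℝ)
    (x : EuclideanSpace ℝ (Fin (n + 1))) : ℝ :=
  sSup {s | s ∈ Icc 0 ℓ ∧ ‖x - Γ s‖ = ⨅ t : Icc 0 ℓ, ‖x - Γ t‖}

/-- The ambiguity points of `Γ`: the points with at least two closest points on `Γ`. -/
def ambiguityPoints {n : ℕ} (Γ : ℝ → EuclideanSpace ℝ (Fin (n + 1))) (ℓ : ℝ) :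
    Set (EuclideanSpace ℝ (Fin (n + 1))) :=
  {x | ∃ y ∈ Γ '' Icc 0 ℓ, ∃ z ∈ Γ '' Icc 0 ℓ, y ≠ z ∧
    (∀ w ∈ Γ '' Icc 0 ℓ, ‖x - y‖ ≤ ‖x - w‖) ∧ (∀ w ∈ Γ '' Icc 0 ℓ, ‖x - z‖ ≤ ‖x - w‖)}

/-- Self-consistency: `E[X | λ_Γ(X)] = Γ(λ_Γ(X))` almost surely, i.e.
`E[X | λ_Γ(X) = s] = Γ(s)` for almost every `s` with respect to the law of `λ_Γ(X)`. -/
def IsSelfConsistent {Ω : Type*} [MeasurableSpace Ω] {n : ℕ} (P : Measure Ω)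
    (X : Ω → EuclideanSpace ℝ (Fin (n + 1)))
    (Γ : ℝ → EuclideanSpace ℝ (Fin (n + 1))) (ℓ : ℝ) : Prop :=
  P[X | MeasurableSpace.comap (fun a => projIndex Γ ℓ (X a)) (borel ℝ)]
    =ᵐ[P] fun a => Γ (projIndex Γ ℓ (X a))

/-- A principal curve of `X`: a smooth, self-consistent Jordan curve. -/
def IsPrincipalCurve {Ω : Type*} [MeasurableSpace Ω] {n : ℕ} (P : Measure Ω)
    (X : Ω → EuclideanSpace ℝ (Fin (n + 1)))
    (Γ : ℝ → EuclideanSpace ℝ (Fin (n + 1))) (ℓ : ℝ) : Prop :=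
  IsSmoothJordanCurve Γ ℓ ∧ IsSelfConsistent P X Γ ℓ

/-- `N₁, …, N_{d-1}` (with `d = n + 1`) complete the tangent of `Γ` to a smooth moving
orthonormal frame. -/
structure IsNormalFrame {n : ℕ} (Γ : ℝ → EuclideanSpace ℝ (Fin (n + 1))) (ℓ : ℝ)
    (N : Fin n → ℝ → EuclideanSpace ℝ (Fin (n + 1))) : Prop where
  smooth : ∀ i, ContDiffOn ℝ ∞ (N i) (Icc 0 ℓ)
  orthonormal : ∀ s ∈ Icc 0 ℓ, Orthonormal ℝ (fun i => N i s)
  normal : ∀ s ∈ Icc 0 ℓ, ∀ i, inner ℝ (tangent Γ ℓ s) (N i s) = 0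

/-- The normal coordinate map `ν_Γ(s, u) = Γ(s) + u₁ N₁(s) + ⋯ + u_{d-1} N_{d-1}(s)`. -/
noncomputable def normalMap {n : ℕ} (Γ : ℝ → EuclideanSpace ℝ (Fin (n + 1)))
    (N : Fin n → ℝ → EuclideanSpace ℝ (Fin (n + 1)))
    (q : ℝ × EuclideanSpace ℝ (Fin n)) : EuclideanSpace ℝ (Fin (n + 1)) :=
  Γ q.1 + ∑ i : Fin n, q.2 i • N i q.1

/-- `f` restricted to `S` is a diffeomorphism onto its image `f(S)`: it is smooth on `S` and
has an inverse `f(S) → S` that is smooth on `f(S)`. -/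
def IsDiffeoOntoImage {A B : Type*} [NormedAddCommGroup A] [NormedSpace ℝ A]
    [NormedAddCommGroup B] [NormedSpace ℝ B] (f : A → B) (S : Set A) : Prop :=
  ContDiffOn ℝ ∞ f S ∧ ∃ g : B → A, ContDiffOn ℝ ∞ g (f '' S) ∧ LeftInvOn g f S

/-- Admissibility of a curve `Γ : [0, ℓ] → 𝕏`: the region `𝕏` contains no ambiguity points of
`Γ`, and the normal coordinate map (for some moving frame), on the part of
`[0, ℓ] × ℝ^{d-1}` that it maps into `𝕏`, is a diffeomorphism onto its image. -/
def IsAdmissible {n : ℕ} (𝕏 : Set (EuclideanSpace ℝ (Fin (n + 1))))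
    (Γ : ℝ → EuclideanSpace ℝ (Fin (n + 1))) (ℓ : ℝ) : Prop :=
  MapsTo Γ (Icc 0 ℓ) 𝕏 ∧
  Disjoint 𝕏 (ambiguityPoints Γ ℓ) ∧
  ∃ N : Fin n → ℝ → EuclideanSpace ℝ (Fin (n + 1)), IsNormalFrame Γ ℓ N ∧
    IsDiffeoOntoImage (normalMap Γ N) {q | q.1 ∈ Icc 0 ℓ ∧ normalMap Γ N q ∈ 𝕏}

end PrincipalCurve

/-! Let `m` be the law of the random vector, λ the projection index, F its distribution function and
I(s) the integral of x over {λ < s}. Self-consistency says dI = Γ dF (`partialMean_sub`).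
Admissibility together with self-consistency makes {λ < s} coincide, up to a null set, with the
half-space behind the normal hyperplane at Γ(s) (`projIndex_lt_iff`).

Call a vector horizontal if its last coordinate is 0. A reflection along a horizontal w orthogonal
to Γ'(s) preserves both `m` and the half-space, so w · I(s) = 0: the horizontal parts of I(s) and
Γ'(s) are parallel (`inner_partialMean_eq_zero`). Hence, on horizontal parts, d(I ∧ Γ) = (Γ ∧ Γ) dF
+ I ∧ Γ' ds = 0, and I(0) = 0 gives I ∧ Γ = 0 (`wedge_partialMean_eq_zero`). Since the horizontal
space has dimension at least 2, some nonzero horizontal w is orthogonal to both Γ and I at the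
midpoint.

This orthogonality propagates by a Gronwall-type argument. Reflection along the horizontal part of
Γ' gives the coercive bound c |w · Γ'| ≤ |w · I|, locally uniformly in s
(`exists_abs_inner_tangent_le`), while I is controlled by Γ through dI = Γ dF. So w · Γ and w · I
vanish near each interior parameter where both vanish (`eventually_inner_eq_zero`), and
connectedness gives w · Γ = 0 everywhere (`exists_inner_eq_zero`). -/

namespace PrincipalCurve

open Filter Topology

variable {n : ℕ} {Γ : ℝ → EuclideanSpace ℝ (Fin (n + 1))} {ℓ : ℝ}
  {𝕏 : Set (EuclideanSpace ℝ (Fin (n + 1)))}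
  {N : Fin n → ℝ → EuclideanSpace ℝ (Fin (n + 1))}
  {p : EuclideanSpace ℝ (Fin (n + 1)) → ℝ}
  {m : Measure (EuclideanSpace ℝ (Fin (n + 1)))}

/-! ### Smooth curves -/

namespace IsSmoothJordanCurve

theorem continuousOn (h : IsSmoothJordanCurve Γ ℓ) : ContinuousOn Γ (Icc 0 ℓ) :=
  h.smooth.continuousOn

theorem continuousOn_tangent (h : IsSmoothJordanCurve Γ ℓ) :
    ContinuousOn (tangent Γ ℓ) (Icc 0 ℓ) :=
  h.smooth.continuousOn_derivWithin (uniqueDiffOn_Icc h.length_pos) (by simp)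

theorem hasDerivWithinAt (h : IsSmoothJordanCurve Γ ℓ) {s : ℝ} (hs : s ∈ Icc 0 ℓ) :
    HasDerivWithinAt Γ (tangent Γ ℓ s) (Icc 0 ℓ) s :=
  (h.smooth.differentiableOn (by simp) s hs).hasDerivWithinAt

theorem hasDerivAt (h : IsSmoothJordanCurve Γ ℓ) {s : ℝ} (hs : s ∈ Ioo 0 ℓ) :
    HasDerivAt Γ (tangent Γ ℓ s) s :=
  (h.hasDerivWithinAt (Ioo_subset_Icc_self hs)).hasDerivAt (Icc_mem_nhds hs.1 hs.2)

theorem left_mem (h : IsSmoothJordanCurve Γ ℓ) : (0 : ℝ) ∈ Icc 0 ℓ :=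
  left_mem_Icc.2 h.length_pos.le

theorem right_mem (h : IsSmoothJordanCurve Γ ℓ) : ℓ ∈ Icc 0 ℓ :=
  right_mem_Icc.2 h.length_pos.le

end IsSmoothJordanCurve

/-! ### The projection index -/

theorem iInf_norm_sub_eq_iff (hℓ : 0 < ℓ) (x : EuclideanSpace ℝ (Fin (n + 1))) {s : ℝ}
    (hs : s ∈ Icc 0 ℓ) :
    ‖x - Γ s‖ = ⨅ t : Icc 0 ℓ, ‖x - Γ t‖ ↔ ∀ t ∈ Icc 0 ℓ, ‖x - Γ s‖ ≤ ‖x - Γ t‖ := by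
  have hb : BddBelow (range fun t : Icc 0 ℓ => ‖x - Γ t‖) :=
    ⟨0, by rintro _ ⟨t, rfl⟩; exact norm_nonneg _⟩
  have : Nonempty (Icc 0 ℓ) := ⟨⟨0, left_mem_Icc.2 hℓ.le⟩⟩
  refine ⟨fun h t ht => h.le.trans (ciInf_le hb ⟨t, ht⟩), fun h => le_antisymm ?_ ?_⟩
  · exact le_ciInf fun t => h t t.2
  · exact ciInf_le hb ⟨s, hs⟩

theorem isCompact_nearest (h : IsSmoothJordanCurve Γ ℓ) (x : EuclideanSpace ℝ (Fin (n + 1))) :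
    IsCompact {s | s ∈ Icc 0 ℓ ∧ ‖x - Γ s‖ = ⨅ t : Icc 0 ℓ, ‖x - Γ t‖} := by
  have hc : ContinuousOn (fun s => ‖x - Γ s‖) (Icc 0 ℓ) :=
    (continuousOn_const.sub h.continuousOn).norm
  exact isCompact_Icc.of_isClosed_subset
    (hc.preimage_isClosed_of_isClosed isClosed_Icc (isClosed_singleton)) fun s hs => hs.1

theorem nonempty_nearest (h : IsSmoothJordanCurve Γ ℓ) (x : EuclideanSpace ℝ (Fin (n + 1))) :
    {s | s ∈ Icc 0 ℓ ∧ ‖x - Γ s‖ = ⨅ t : Icc 0 ℓ, ‖x - Γ t‖}.Nonempty := by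
  have hc : ContinuousOn (fun s => ‖x - Γ s‖) (Icc 0 ℓ) :=
    (continuousOn_const.sub h.continuousOn).norm
  obtain ⟨s, hs, hmin⟩ := isCompact_Icc.exists_isMinOn ⟨0, h.left_mem⟩ hc
  exact ⟨s, hs, (iInf_norm_sub_eq_iff h.length_pos x hs).2 fun t ht => hmin ht⟩

theorem projIndex_mem (h : IsSmoothJordanCurve Γ ℓ) (x : EuclideanSpace ℝ (Fin (n + 1))) :
    projIndex Γ ℓ x ∈ Icc 0 ℓ :=
  ((isCompact_nearest h x).sSup_mem (nonempty_nearest h x)).1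

theorem norm_sub_projIndex_le (h : IsSmoothJordanCurve Γ ℓ)
    (x : EuclideanSpace ℝ (Fin (n + 1))) {t : ℝ} (ht : t ∈ Icc 0 ℓ) :
    ‖x - Γ (projIndex Γ ℓ x)‖ ≤ ‖x - Γ t‖ :=
  (iInf_norm_sub_eq_iff h.length_pos x (projIndex_mem h x)).1
    ((isCompact_nearest h x).sSup_mem (nonempty_nearest h x)).2 t ht

theorem le_projIndex (h : IsSmoothJordanCurve Γ ℓ)
    {x : EuclideanSpace ℝ (Fin (n + 1))} {s : ℝ} (hs : s ∈ Icc 0 ℓ)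
    (hmin : ∀ t ∈ Icc 0 ℓ, ‖x - Γ s‖ ≤ ‖x - Γ t‖) : s ≤ projIndex Γ ℓ x :=
  le_csSup (isCompact_nearest h x).bddAbove
    ⟨hs, (iInf_norm_sub_eq_iff h.length_pos x hs).2 hmin⟩

/-- Because λ is the largest nearest parameter, λ(x) ≥ a means that the final arc over [a, ℓ] is as
close to x as the whole curve: a closed condition. The nonemptiness clause is there because
`infDist` to the empty set is 0. -/
theorem measurable_projIndex (h : IsSmoothJordanCurve Γ ℓ) : Measurable (projIndex Γ ℓ) := by
  refine measurable_of_Ici fun a => ?_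
  have key : projIndex Γ ℓ ⁻¹' Ici a = {x | (Γ '' (Icc 0 ℓ ∩ Ici a)).Nonempty ∧
      Metric.infDist x (Γ '' (Icc 0 ℓ ∩ Ici a)) ≤ Metric.infDist x (Γ '' Icc 0 ℓ)} := by
    have hne : (Γ '' Icc 0 ℓ).Nonempty := ⟨_, mem_image_of_mem _ h.left_mem⟩
    ext x
    constructor
    · intro hx
      have hmem : Γ (projIndex Γ ℓ x) ∈ Γ '' (Icc 0 ℓ ∩ Ici a) :=
        mem_image_of_mem _ ⟨projIndex_mem h x, hx⟩
      refine ⟨⟨_, hmem⟩, (Metric.infDist_le_dist_of_mem hmem).trans ?_⟩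
      refine (Metric.le_infDist hne).2 ?_
      rintro _ ⟨t, ht, rfl⟩
      rw [dist_eq_norm, dist_eq_norm]
      exact norm_sub_projIndex_le h x ht
    · rintro ⟨hn, hle⟩
      have hK : IsCompact (Γ '' (Icc 0 ℓ ∩ Ici a)) :=
        (isCompact_Icc.inter_right isClosed_Ici).image_of_continuousOn
          (h.continuousOn.mono inter_subset_left)
      obtain ⟨_, ⟨s, hs, rfl⟩, hd⟩ := hK.exists_infDist_eq_dist hn x
      refine le_trans hs.2 (le_projIndex h hs.1 fun t ht => ?_)
      rw [← dist_eq_norm, ← dist_eq_norm, ← hd]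
      exact hle.trans (Metric.infDist_le_dist_of_mem (mem_image_of_mem _ ht))
  rw [key]
  by_cases hn : (Γ '' (Icc 0 ℓ ∩ Ici a)).Nonempty
  · simp only [hn, true_and]
    exact (isClosed_le (Metric.continuous_infDist_pt _)
      (Metric.continuous_infDist_pt _)).measurableSet
  · simp [hn]

theorem eq_projIndex (h : IsSmoothJordanCurve Γ ℓ) (hd : Disjoint 𝕏 (ambiguityPoints Γ ℓ))
    {x : EuclideanSpace ℝ (Fin (n + 1))} (hx : x ∈ 𝕏) {s : ℝ} (hs : s ∈ Icc 0 ℓ)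
    (hmin : ∀ t ∈ Icc 0 ℓ, ‖x - Γ s‖ ≤ ‖x - Γ t‖) : s = projIndex Γ ℓ x := by
  by_contra hne
  refine disjoint_left.1 hd hx ⟨Γ s, mem_image_of_mem _ hs, Γ (projIndex Γ ℓ x),
    mem_image_of_mem _ (projIndex_mem h x), fun he => hne (h.injOn hs (projIndex_mem h x) he),
    ?_, ?_⟩
  · rintro _ ⟨t, ht, rfl⟩
    exact hmin t ht
  · rintro _ ⟨t, ht, rfl⟩
    exact norm_sub_projIndex_le h x ht

theorem projIndex_apply (h : IsSmoothJordanCurve Γ ℓ) (hd : Disjoint 𝕏 (ambiguityPoints Γ ℓ))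
    (hmaps : MapsTo Γ (Icc 0 ℓ) 𝕏) {s : ℝ} (hs : s ∈ Icc 0 ℓ) : projIndex Γ ℓ (Γ s) = s :=
  (eq_projIndex h hd (hmaps hs) hs fun t _ => by simp).symm

/-- Every cluster value of λ at x is the parameter of a closest point to x, and there is only one
such parameter; compactness of [0, ℓ] does the rest. -/
theorem continuousOn_projIndex (h : IsSmoothJordanCurve Γ ℓ)
    (hd : Disjoint 𝕏 (ambiguityPoints Γ ℓ)) : ContinuousOn (projIndex Γ ℓ) 𝕏 := by
  intro x hx
  refine isCompact_Icc.tendsto_nhds_of_unique_mapClusterPt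
    (Eventually.of_forall fun y => projIndex_mem h y) fun s hs hcl => ?_
  refine eq_projIndex h hd hx hs fun t ht => ?_
  obtain ⟨U, hU, hUt⟩ := mapClusterPt_iff_ultrafilter.1 hcl
  have hUx : Tendsto id (U : Filter _) (𝓝 x) := hU.trans nhdsWithin_le_nhds
  have hΓ : Tendsto (fun y => Γ (projIndex Γ ℓ y)) U (𝓝 (Γ s)) :=
    (h.continuousOn s hs).tendsto.comp (tendsto_nhdsWithin_iff.2
      ⟨hUt, Eventually.of_forall fun y => projIndex_mem h y⟩)
  exact le_of_tendsto_of_tendsto' (hUx.sub hΓ).norm (hUx.sub tendsto_const_nhds).norm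
    fun y => norm_sub_projIndex_le h y ht

/-- The signed distance of `x` from the hyperplane normal to `Γ` at `Γ(s)`. -/
noncomputable def normalHeight (Γ : ℝ → EuclideanSpace ℝ (Fin (n + 1))) (ℓ s : ℝ)
    (x : EuclideanSpace ℝ (Fin (n + 1))) : ℝ :=
  inner ℝ (x - Γ s) (tangent Γ ℓ s)

theorem continuousOn_normalHeight (h : IsSmoothJordanCurve Γ ℓ) {α : Type*} [TopologicalSpace α]
    {S : Set α} {a : α → ℝ} {b : α → EuclideanSpace ℝ (Fin (n + 1))} (ha : ContinuousOn a S)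
    (hb : ContinuousOn b S) (hS : MapsTo a S (Icc 0 ℓ)) :
    ContinuousOn (fun z => normalHeight Γ ℓ (a z) (b z)) S :=
  (hb.sub (h.continuousOn.comp ha hS)).inner (h.continuousOn_tangent.comp ha hS)

theorem hasDerivWithinAt_sq_dist (h : IsSmoothJordanCurve Γ ℓ)
    (x : EuclideanSpace ℝ (Fin (n + 1))) {s : ℝ} (hs : s ∈ Icc 0 ℓ) :
    HasDerivWithinAt (fun t => ‖x - Γ t‖ ^ 2) (-(2 * normalHeight Γ ℓ s x)) (Icc 0 ℓ) s := by
  have := ((h.hasDerivWithinAt hs).const_sub x).norm_sq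
  simpa [normalHeight] using this

/-- First-order condition for the squared distance at its minimum over an interval: equality at
interior parameters, only a sign at the two ends. -/
theorem normalHeight_mul_sub_nonpos (h : IsSmoothJordanCurve Γ ℓ)
    (x : EuclideanSpace ℝ (Fin (n + 1))) {t : ℝ} (ht : t ∈ Icc 0 ℓ) :
    normalHeight Γ ℓ (projIndex Γ ℓ x) x * (t - projIndex Γ ℓ x) ≤ 0 := by
  set s := projIndex Γ ℓ x with hsdef
  have hs : s ∈ Icc 0 ℓ := projIndex_mem h x
  have hmin : IsMinOn (fun t => ‖x - Γ t‖ ^ 2) (Icc 0 ℓ) s := fun r hr =>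
    pow_le_pow_left₀ (norm_nonneg _) (norm_sub_projIndex_le h x hr) 2
  have := hmin.localize.hasFDerivWithinAt_nonneg (hasDerivWithinAt_sq_dist h x hs)
    (sub_mem_posTangentConeAt_of_segment_subset ((convex_Icc 0 ℓ).segment_subset hs ht))
  simp at this
  linarith

/-! ### Slices of the region -/

theorem exists_normalMap_eq (h : IsSmoothJordanCurve Γ ℓ) (hN : IsNormalFrame Γ ℓ N) {s : ℝ}
    (hs : s ∈ Icc 0 ℓ) {x : EuclideanSpace ℝ (Fin (n + 1))} (hx : normalHeight Γ ℓ s x = 0) :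
    ∃ u, normalMap Γ N (s, u) = x := by
  have ho : Orthonormal ℝ (Fin.cons (tangent Γ ℓ s) fun i => N i s :
      Fin (n + 1) → EuclideanSpace ℝ (Fin (n + 1))) := by
    constructor
    · intro i
      refine Fin.cases ?_ (fun i => ?_) i
      · simpa using h.arcLength s hs
      · simpa using (hN.orthonormal s hs).1 i
    · intro i j hij
      induction i using Fin.cases with
      | zero =>
        induction j using Fin.cases with
        | zero => exact absurd rfl hij
        | succ j => simpa using hN.normal s hs j
      | succ i =>
        induction j using Fin.cases with
        | zero => simpa [real_inner_comm] using hN.normal s hs i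
        | succ j => simpa using (hN.orthonormal s hs).2 fun e => hij (by rw [e])
  let b := (basisOfOrthonormalOfCardEqFinrank ho (by simp)).toOrthonormalBasis (by simpa using ho)
  have hb : ⇑b = Fin.cons (tangent Γ ℓ s) fun i => N i s := by simp [b]
  have hsum := b.sum_repr' (x - Γ s)
  rw [hb, Fin.sum_univ_succ] at hsum
  simp only [Fin.cons_zero, Fin.cons_succ] at hsum
  rw [real_inner_comm, show inner ℝ (x - Γ s) (tangent Γ ℓ s) = 0 from hx, zero_smul,
    zero_add] at hsum
  refine ⟨WithLp.toLp 2 fun i => inner ℝ (N i s) (x - Γ s), ?_⟩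
  simp only [normalMap]
  rw [hsum, add_sub_cancel]

/-- The image of the connected interior under λ is an interval. Its closure contains every r, since
λ(Γ(r)) = r and Γ(r) is a limit of interior points. -/
theorem exists_projIndex_eq (h : IsSmoothJordanCurve Γ ℓ) (h𝕏 : IsCompactRegion 𝕏)
    (hd : Disjoint 𝕏 (ambiguityPoints Γ ℓ)) (hmaps : MapsTo Γ (Icc 0 ℓ) 𝕏) {s : ℝ}
    (hs : s ∈ Ioo 0 ℓ) : ∃ x ∈ interior 𝕏, projIndex Γ ℓ x = s := by
  have hc := continuousOn_projIndex h hd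
  have hpre := h𝕏.isConnected_interior.isPreconnected.image _ (hc.mono interior_subset)
  have hdense : ∀ r ∈ Icc 0 ℓ, r ∈ closure (projIndex Γ ℓ '' interior 𝕏) := by
    intro r hr
    have hmem : Γ r ∈ closure (interior 𝕏) := by rw [h𝕏.closure_interior]; exact hmaps hr
    have := (hc.mono h𝕏.closure_interior.subset).image_closure
        (mem_image_of_mem (projIndex Γ ℓ) hmem)
    rwa [projIndex_apply h hd hmaps hr] at this
  obtain ⟨a, ha, ha'⟩ := mem_closure_iff.1 (hdense 0 h.left_mem) (Iio s) isOpen_Iio hs.1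
  obtain ⟨b, hb, hb'⟩ := mem_closure_iff.1 (hdense ℓ h.right_mem) (Ioi s) isOpen_Ioi hs.2
  exact hpre.ordConnected.out ha' hb' ⟨le_of_lt ha, le_of_lt hb⟩

theorem continuousOn_normalHeight_projIndex (h : IsSmoothJordanCurve Γ ℓ)
    (hd : Disjoint 𝕏 (ambiguityPoints Γ ℓ)) :
    ContinuousOn (fun x => normalHeight Γ ℓ (projIndex Γ ℓ x) x) 𝕏 :=
  continuousOn_normalHeight h (continuousOn_projIndex h hd) continuousOn_id
    fun x _ => projIndex_mem h x

/-- Only points projected to an end of the curve can violate orthogonality. In the interior of 𝕏 the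
violating points form an open set, which is null by `h0` and `h1`, hence empty; continuity extends
this to 𝕏. -/
theorem normalHeight_projIndex_eq_zero (h : IsSmoothJordanCurve Γ ℓ) (h𝕏 : IsCompactRegion 𝕏)
    (hd : Disjoint 𝕏 (ambiguityPoints Γ ℓ))
    {m : Measure (EuclideanSpace ℝ (Fin (n + 1)))}
    (hm : ∀ O ⊆ interior 𝕏, IsOpen O → m O = 0 → O = ∅)
    (h0 : m (projIndex Γ ℓ ⁻¹' {0}) = 0) (h1 : m (projIndex Γ ℓ ⁻¹' {ℓ}) = 0)
    {x : EuclideanSpace ℝ (Fin (n + 1))} (hx : x ∈ 𝕏) :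
    normalHeight Γ ℓ (projIndex Γ ℓ x) x = 0 := by
  have hc := continuousOn_normalHeight_projIndex h hd
  have hint : ∀ y ∈ interior 𝕏, normalHeight Γ ℓ (projIndex Γ ℓ y) y = 0 := by
    have hO := hm (interior 𝕏 ∩ (fun x => normalHeight Γ ℓ (projIndex Γ ℓ x) x) ⁻¹' {0}ᶜ)
      inter_subset_left ((hc.mono interior_subset).isOpen_inter_preimage isOpen_interior
        isOpen_compl_singleton) (measure_mono_null (fun y hy => ?_) (measure_union_null h0 h1))
    · intro y hy
      by_contra hne
      exact (hO.subset ⟨hy, hne⟩ : y ∈ (∅ : Set _))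
    · have hy2 : normalHeight Γ ℓ (projIndex Γ ℓ y) y ≠ 0 := hy.2
      have hmem := projIndex_mem h y
      have e0 := normalHeight_mul_sub_nonpos h y h.left_mem
      have e1 := normalHeight_mul_sub_nonpos h y h.right_mem
      rcases hmem.1.eq_or_lt with e | l0
      · exact Or.inl e.symm
      rcases hmem.2.eq_or_lt with e | l1
      · exact Or.inr e
      exfalso
      rcases hy2.lt_or_gt with l | l
      · nlinarith
      · nlinarith
  have hx' : x ∈ closure (interior 𝕏) := by rwa [h𝕏.closure_interior]
  have := (hc.mono h𝕏.closure_interior.subset).image_closure (mem_image_of_mem _ hx')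
  have hsub : (fun x => normalHeight Γ ℓ (projIndex Γ ℓ x) x) '' interior 𝕏 ⊆ {0} := by
    rintro _ ⟨y, hy, rfl⟩
    exact hint y hy
  simpa using closure_mono hsub this

theorem eq_projIndex_of_normalHeight_eq_zero (h : IsSmoothJordanCurve Γ ℓ)
    (hN : IsNormalFrame Γ ℓ N)
    (hinj : InjOn (normalMap Γ N) {q | q.1 ∈ Icc 0 ℓ ∧ normalMap Γ N q ∈ 𝕏})
    (hz : ∀ x ∈ 𝕏, normalHeight Γ ℓ (projIndex Γ ℓ x) x = 0)
    {x : EuclideanSpace ℝ (Fin (n + 1))} (hx : x ∈ 𝕏) {s : ℝ} (hs : s ∈ Icc 0 ℓ)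
    (hsx : normalHeight Γ ℓ s x = 0) : s = projIndex Γ ℓ x := by
  obtain ⟨u, hu⟩ := exists_normalMap_eq h hN hs hsx
  obtain ⟨v, hv⟩ := exists_normalMap_eq h hN (projIndex_mem h x) (hz x hx)
  exact congrArg Prod.fst (hinj ⟨hs, by rwa [hu]⟩ ⟨projIndex_mem h x, by rwa [hv]⟩
    (hu.trans hv.symm))

/-- By injectivity of the normal coordinates, the height of x over the normal hyperplane at r
vanishes only for r = λ(x), so it keeps its sign on each side of λ(x). The wrong sign would make the
distance strictly decrease away from λ(x), contradicting minimality. -/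
theorem projIndex_lt_iff (h : IsSmoothJordanCurve Γ ℓ)
    (hN : IsNormalFrame Γ ℓ N)
    (hinj : InjOn (normalMap Γ N) {q | q.1 ∈ Icc 0 ℓ ∧ normalMap Γ N q ∈ 𝕏})
    (hz : ∀ x ∈ 𝕏, normalHeight Γ ℓ (projIndex Γ ℓ x) x = 0)
    {x : EuclideanSpace ℝ (Fin (n + 1))} (hx : x ∈ 𝕏) {s : ℝ} (hs : s ∈ Icc 0 ℓ) :
    projIndex Γ ℓ x < s ↔ normalHeight Γ ℓ s x < 0 := by
  set t := projIndex Γ ℓ x with htdef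
  have ht : t ∈ Icc 0 ℓ := projIndex_mem h x
  have huniq : ∀ r ∈ Icc 0 ℓ, normalHeight Γ ℓ r x = 0 → r = t := fun r hr hrx =>
    eq_projIndex_of_normalHeight_eq_zero h hN hinj hz hx hr hrx
  have hcont : ContinuousOn (fun r => normalHeight Γ ℓ r x) (Icc 0 ℓ) :=
    continuousOn_normalHeight h continuousOn_id continuousOn_const fun r hr => hr
  have hφ : ContinuousOn (fun r => ‖x - Γ r‖ ^ 2) (Icc 0 ℓ) := fun r hr =>
    (hasDerivWithinAt_sq_dist h x hr).continuousWithinAt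
  have hderiv : ∀ r ∈ Ioo 0 ℓ, deriv (fun r => ‖x - Γ r‖ ^ 2) r = -(2 * normalHeight Γ ℓ r x) :=
    fun r hr => ((hasDerivWithinAt_sq_dist h x (Ioo_subset_Icc_self hr)).hasDerivAt
      (Icc_mem_nhds hr.1 hr.2)).deriv
  have hmin : ‖x - Γ t‖ ^ 2 ≤ ‖x - Γ s‖ ^ 2 :=
    pow_le_pow_left₀ (norm_nonneg _) (norm_sub_projIndex_le h x hs) 2
  have hsign : ∀ r ∈ Icc 0 ℓ, ∀ r' ∈ Icc 0 ℓ, normalHeight Γ ℓ r x < 0 →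
      0 < normalHeight Γ ℓ r' x → t ∈ uIcc r r' := by
    intro r hr r' hr' h1 h2
    have hsub : uIcc r r' ⊆ Icc 0 ℓ := uIcc_subset_Icc hr hr'
    obtain ⟨q, hq, hq0⟩ := intermediate_value_uIcc (hcont.mono hsub)
      (mem_uIcc.2 (Or.inl ⟨h1.le, h2.le⟩))
    rwa [← huniq q (hsub hq) hq0]
  constructor
  · intro hts
    by_contra hcon
    have hpos : 0 < normalHeight Γ ℓ s x :=
      lt_of_le_of_ne (not_lt.1 hcon) fun e => hts.ne' (huniq s hs e.symm)
    have hsub : Icc t s ⊆ Icc 0 ℓ := Icc_subset_Icc ht.1 hs.2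
    have := strictAntiOn_of_deriv_neg (convex_Icc t s) (hφ.mono hsub) (by
      intro r hr
      rw [interior_Icc] at hr
      have hr' : r ∈ Icc 0 ℓ := hsub (Ioo_subset_Icc_self hr)
      rw [hderiv r ⟨ht.1.trans_lt hr.1, hr.2.trans_le hs.2⟩]
      have hne : normalHeight Γ ℓ r x ≠ 0 := fun e => hr.1.ne' (huniq r hr' e)
      have : 0 < normalHeight Γ ℓ r x := by
        by_contra hle
        have := hsign r hr' s hs (lt_of_le_of_ne (not_lt.1 hle) hne) hpos
        rw [uIcc_of_le hr.2.le] at this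
        exact absurd this.1 (not_le.2 hr.1)
      linarith) (left_mem_Icc.2 hts.le) (right_mem_Icc.2 hts.le) hts
    exact absurd this (not_lt.2 hmin)
  · intro hneg
    by_contra hcon
    have hst : s < t := lt_of_le_of_ne (not_lt.1 hcon) fun e => by
      have := hz x hx
      rw [← htdef, ← e] at this
      exact hneg.ne this
    have hsub : Icc s t ⊆ Icc 0 ℓ := Icc_subset_Icc hs.1 ht.2
    have := strictMonoOn_of_deriv_pos (convex_Icc s t) (hφ.mono hsub) (by
      intro r hr
      rw [interior_Icc] at hr
      have hr' : r ∈ Icc 0 ℓ := hsub (Ioo_subset_Icc_self hr)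
      rw [hderiv r ⟨hs.1.trans_lt hr.1, hr.2.trans_le ht.2⟩]
      have hne : normalHeight Γ ℓ r x ≠ 0 := fun e => hr.2.ne (huniq r hr' e)
      have : normalHeight Γ ℓ r x < 0 := by
        by_contra hle
        have := hsign s hs r hr' hneg (lt_of_le_of_ne (not_lt.1 hle) hne.symm)
        rw [uIcc_of_le hr.1.le] at this
        exact absurd this.2 (not_le.2 hr.2)
      linarith) (left_mem_Icc.2 hst.le) (right_mem_Icc.2 hst.le) hst
    exact absurd this (not_lt.2 hmin)

/-! ### The law of the random vector -/

theorem RotationallySymmetric.comp_eq (hsym : RotationallySymmetric p)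
    (R : EuclideanSpace ℝ (Fin (n + 1)) ≃ₗᵢ[ℝ] EuclideanSpace ℝ (Fin (n + 1)))
    (hR : ∀ x, R x (Fin.last n) = x (Fin.last n)) (x : EuclideanSpace ℝ (Fin (n + 1))) :
    p (R x) = p x := by
  refine hsym _ _ (hR x) ?_
  congr 1
  have h1 := R.norm_map x
  rw [EuclideanSpace.norm_eq, EuclideanSpace.norm_eq,
    Real.sqrt_inj (by positivity) (by positivity), Fin.sum_univ_castSucc,
    Fin.sum_univ_castSucc, hR x] at h1
  simpa using h1

theorem map_withDensity_of_comp_eq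
    (R : EuclideanSpace ℝ (Fin (n + 1)) ≃ₗᵢ[ℝ] EuclideanSpace ℝ (Fin (n + 1)))
    (hR : ∀ x, p (R x) = p x) :
    (volume.withDensity fun x => ENNReal.ofReal (p x)).map R =
      volume.withDensity fun x => ENNReal.ofReal (p x) := by
  ext S hS
  have hRm : Measurable R := R.continuous.measurable
  rw [Measure.map_apply hRm hS, withDensity_apply _ (hRm hS), withDensity_apply _ hS,
    ← R.measurePreserving.setLIntegral_comp_preimage_emb
      R.toHomeomorph.measurableEmbedding (fun x => ENNReal.ofReal (p x)) S]
  simp only [hR]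

theorem volume_hyperplane_eq_zero {v : EuclideanSpace ℝ (Fin (n + 1))} (hv : v ≠ 0)
    (a : EuclideanSpace ℝ (Fin (n + 1))) :
    volume {x : EuclideanSpace ℝ (Fin (n + 1)) | inner ℝ (x - a) v = 0} = 0 := by
  have hset : {x : EuclideanSpace ℝ (Fin (n + 1)) | inner ℝ (x - a) v = 0} =
      (AffineSubspace.mk' a (ℝ ∙ v)ᗮ : Set (EuclideanSpace ℝ (Fin (n + 1)))) := by
    ext x
    simp [AffineSubspace.mem_mk', Submodule.mem_orthogonal_singleton_iff_inner_left]
  rw [hset]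
  refine Measure.addHaar_affineSubspace volume _ fun h => hv ?_
  have hdir := congrArg AffineSubspace.direction h
  rw [AffineSubspace.direction_mk', AffineSubspace.direction_top] at hdir
  have : v ∈ (ℝ ∙ v)ᗮ := hdir ▸ Submodule.mem_top
  exact inner_self_eq_zero.1 (Submodule.mem_orthogonal_singleton_iff_inner_left.1 this)

/-- What is used of the law `m` of the random vector and of its principal curve: the sublevel
sets of the projection index are half-spaces, `m` is invariant under the isometries that
preserve the last coordinate, and `m` charges the neighbourhood of some point of each slice. -/
structure SymmetricPrincipalLaw (m : Measure (EuclideanSpace ℝ (Fin (n + 1))))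
    (Γ : ℝ → EuclideanSpace ℝ (Fin (n + 1))) (ℓ : ℝ) : Prop where
  curve : IsSmoothJordanCurve Γ ℓ
  prob : IsProbabilityMeasure m
  integrable : Integrable (fun x => x) m
  selfConsistent : ∀ B, MeasurableSet B →
    ∫ x in projIndex Γ ℓ ⁻¹' B, x ∂m = ∫ x in projIndex Γ ℓ ⁻¹' B, Γ (projIndex Γ ℓ x) ∂m
  lt_iff : ∀ᵐ x ∂m, ∀ s ∈ Icc 0 ℓ, projIndex Γ ℓ x < s ↔ normalHeight Γ ℓ s x < 0
  fiber_null : ∀ s ∈ Icc 0 ℓ, m (projIndex Γ ℓ ⁻¹' {s}) = 0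
  map_eq : ∀ R : EuclideanSpace ℝ (Fin (n + 1)) ≃ₗᵢ[ℝ] EuclideanSpace ℝ (Fin (n + 1)),
    (∀ x, R x (Fin.last n) = x (Fin.last n)) → m.map R = m
  slice : ∀ s ∈ Ioo 0 ℓ, ∃ x, normalHeight Γ ℓ s x = 0 ∧ ∃ δ > 0, ∃ c > 0,
    ∀ S ⊆ Metric.ball x δ, MeasurableSet S → ENNReal.ofReal c * volume S ≤ m S

theorem measurable_comp_projIndex (h : IsSmoothJordanCurve Γ ℓ) :
    Measurable fun x => Γ (projIndex Γ ℓ x) := by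
  -- Γ is arbitrary off [0, ℓ], so it is replaced by a continuous extension of its restriction.
  have hc : Continuous (IccExtend h.length_pos.le ((Icc 0 ℓ).domRestrict Γ)) :=
    (continuousOn_iff_continuous_domRestrict.1 h.continuousOn).Icc_extend'
  convert! hc.measurable.comp (measurable_projIndex h) using 1
  funext x
  simp [IccExtend_of_mem h.length_pos.le _ (projIndex_mem h x)]

theorem integrable_comp_projIndex (h : IsSmoothJordanCurve Γ ℓ)
    (m : Measure (EuclideanSpace ℝ (Fin (n + 1)))) [IsFiniteMeasure m] :
    Integrable (fun x => Γ (projIndex Γ ℓ x)) m := by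
  obtain ⟨C, hC⟩ := isCompact_Icc.exists_bound_of_continuousOn h.continuousOn
  exact Integrable.of_bound (measurable_comp_projIndex h).aestronglyMeasurable C
    (Eventually.of_forall fun x => hC _ (projIndex_mem h x))

theorem IsSelfConsistent.setIntegral_eq {Ω : Type*} [MeasurableSpace Ω] {P : Measure Ω}
    [IsProbabilityMeasure P] {X : Ω → EuclideanSpace ℝ (Fin (n + 1))} (hX : Measurable X)
    (h : IsSmoothJordanCurve Γ ℓ) (hsc : IsSelfConsistent P X Γ ℓ) (hi : Integrable X P)
    {B : Set ℝ} (hB : MeasurableSet B) :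
    ∫ x in projIndex Γ ℓ ⁻¹' B, x ∂(P.map X) =
      ∫ x in projIndex Γ ℓ ⁻¹' B, Γ (projIndex Γ ℓ x) ∂(P.map X) := by
  have hlam := measurable_projIndex h
  have hS : MeasurableSet (projIndex Γ ℓ ⁻¹' B) := hlam hB
  have hle : MeasurableSpace.comap (fun a => projIndex Γ ℓ (X a)) (borel ℝ) ≤
      ‹MeasurableSpace Ω› := by
    rw [← BorelSpace.measurable_eq]
    exact (hlam.comp hX).comap_le
  rw [setIntegral_map (f := fun x => x) hS aestronglyMeasurable_id hX.aemeasurable,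
    setIntegral_map hS (measurable_comp_projIndex h).aestronglyMeasurable hX.aemeasurable,
    ← integral_congr_ae (ae_restrict_of_ae hsc)]
  refine (setIntegral_condExp hle hi ?_).symm
  exact ⟨B, by rwa [← BorelSpace.measurable_eq], rfl⟩

/-- Self-consistency on the single fibre makes the mean of x - Γ(s) there zero, so the height
integrates to zero. A height of one strict sign off a null hyperplane then forces the fibre to be
null. This serves the two end parameters. -/
theorem measure_projIndex_fiber_eq_zero_of_sign (h : IsSmoothJordanCurve Γ ℓ)
    {m : Measure (EuclideanSpace ℝ (Fin (n + 1)))} [IsFiniteMeasure m]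
    (hi : Integrable (fun x => x) m)
    (hsc : ∀ B, MeasurableSet B →
      ∫ x in projIndex Γ ℓ ⁻¹' B, x ∂m = ∫ x in projIndex Γ ℓ ⁻¹' B, Γ (projIndex Γ ℓ x) ∂m)
    {s : ℝ} (hnull : m {x | normalHeight Γ ℓ s x = 0} = 0) (σ : ℝ)
    (hσ : ∀ x, projIndex Γ ℓ x = s → normalHeight Γ ℓ s x ≠ 0 → 0 < σ * normalHeight Γ ℓ s x) :
    m (projIndex Γ ℓ ⁻¹' {s}) = 0 := by
  set A := projIndex Γ ℓ ⁻¹' {s} with hA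
  have hAm : MeasurableSet A := measurable_projIndex h (measurableSet_singleton s)
  have h1 : ∫ x in A, (x - Γ s) ∂m = 0 := by
    rw [integral_sub hi.integrableOn (integrable_const _), hsc {s} (measurableSet_singleton s),
      sub_eq_zero]
    exact setIntegral_congr_fun hAm fun x hx => by
      rw [show projIndex Γ ℓ x = s from hx]
  have hi1 : Integrable (fun x => x - Γ s) (m.restrict A) :=
    hi.integrableOn.sub (integrable_const _)
  have h2 : ∫ x in A, σ * normalHeight Γ ℓ s x ∂m = 0 := by
    have := integral_inner (𝕜 := ℝ) hi1 (tangent Γ ℓ s)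
    rw [h1, inner_zero_right] at this
    rw [integral_const_mul]
    simp only [normalHeight, real_inner_comm (tangent Γ ℓ s)] at this ⊢
    rw [this, mul_zero]
  have hi2 : Integrable (fun x => σ * normalHeight Γ ℓ s x) (m.restrict A) :=
    (hi1.inner_const (𝕜 := ℝ) (tangent Γ ℓ s)).const_mul σ
  have hnn : 0 ≤ᵐ[m.restrict A] fun x => σ * normalHeight Γ ℓ s x := by
    filter_upwards [ae_restrict_mem hAm] with x hx
    by_cases h0 : normalHeight Γ ℓ s x = 0
    · simp [h0]
    · exact (hσ x hx h0).le
  have h3 := (ae_restrict_iff' hAm).1 ((integral_eq_zero_iff_of_nonneg_ae hnn hi2).1 h2)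
  have h4 : ∀ᵐ x ∂m, x ∉ A := by
    filter_upwards [h3, measure_eq_zero_iff_ae_notMem.1 hnull] with x hx hx0 hxA
    exact (hσ x hxA hx0).ne' (hx hxA)
  exact measure_eq_zero_iff_ae_notMem.2 h4

theorem symmetricPrincipalLaw {Ω : Type*} [MeasurableSpace Ω] {P : Measure Ω}
    [IsProbabilityMeasure P] (h𝕏 : IsCompactRegion 𝕏) (hp : IsSmoothDensityOn p 𝕏)
    (hsym : RotationallySymmetric p) {X : Ω → EuclideanSpace ℝ (Fin (n + 1))}
    (hX : HasDensity P X p) (hΓ : IsPrincipalCurve P X Γ ℓ) (hadm : IsAdmissible 𝕏 Γ ℓ) :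
    SymmetricPrincipalLaw (P.map X) Γ ℓ := by
  obtain ⟨hXm, hmap⟩ := hX
  obtain ⟨h, hsc⟩ := hΓ
  obtain ⟨hmaps, hd, N, hN, -, g, -, hg⟩ := hadm
  have hprob : IsProbabilityMeasure (P.map X) := Measure.isProbabilityMeasure_map hXm.aemeasurable
  have hmem : ∀ᵐ x ∂(P.map X), x ∈ 𝕏 := by
    have : (P.map X) 𝕏ᶜ = 0 := by
      rw [hmap, withDensity_apply _ h𝕏.isCompact.isClosed.measurableSet.compl]
      refine (setLIntegral_congr_fun h𝕏.isCompact.isClosed.measurableSet.compl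
        fun x hx => ?_).trans (lintegral_zero)
      rw [image_eq_zero_of_notMem_tsupport (f := p) (by rwa [hp.support_eq]), ENNReal.ofReal_zero]
    simpa using measure_eq_zero_iff_ae_notMem.1 this
  have hi : Integrable (fun x => x) (P.map X) := by
    obtain ⟨C, hC⟩ := h𝕏.isCompact.isBounded.exists_norm_le
    exact Integrable.of_bound aestronglyMeasurable_id C (hmem.mono fun x hx => hC x hx)
  have hiX : Integrable X P := by
    simpa [Function.comp_def] using
      (integrable_map_measure aestronglyMeasurable_id hXm.aemeasurable).1 hi
  have hself : ∀ B, MeasurableSet B → ∫ x in projIndex Γ ℓ ⁻¹' B, x ∂(P.map X) =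
      ∫ x in projIndex Γ ℓ ⁻¹' B, Γ (projIndex Γ ℓ x) ∂(P.map X) :=
    fun B hB => hsc.setIntegral_eq hXm h hiX hB
  have hac : P.map X ≪ volume := by
    rw [hmap]
    exact withDensity_absolutelyContinuous _ _
  have hplane : ∀ s ∈ Icc 0 ℓ, (P.map X) {x | normalHeight Γ ℓ s x = 0} = 0 := fun s hs =>
    hac (volume_hyperplane_eq_zero (norm_ne_zero_iff.1 (by
      rw [h.arcLength s hs]; exact one_ne_zero)) _)
  have h0 : (P.map X) (projIndex Γ ℓ ⁻¹' {0}) = 0 :=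
    measure_projIndex_fiber_eq_zero_of_sign h hi hself (hplane 0 h.left_mem) (-1)
      fun x hx hne => by
        have := normalHeight_mul_sub_nonpos h x h.right_mem
        rw [hx, sub_zero] at this
        have hlt := lt_of_le_of_ne (nonpos_of_mul_nonpos_left this h.length_pos) hne
        linarith
  have h1 : (P.map X) (projIndex Γ ℓ ⁻¹' {ℓ}) = 0 :=
    measure_projIndex_fiber_eq_zero_of_sign h hi hself (hplane ℓ h.right_mem) 1
      fun x hx hne => by
        have := normalHeight_mul_sub_nonpos h x h.left_mem
        rw [hx, zero_sub, mul_neg, neg_nonpos] at this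
        rw [one_mul]
        exact lt_of_le_of_ne (nonneg_of_mul_nonneg_left this h.length_pos) hne.symm
  have hlow : ∀ x ∈ interior 𝕏, ∃ δ > 0, ∃ c > 0, ∀ S ⊆ Metric.ball x δ, MeasurableSet S →
      ENNReal.ofReal c * volume S ≤ (P.map X) S := by
    intro x hx
    have hcont : ContinuousAt p x :=
      hp.smooth.continuousOn.continuousAt (mem_interior_iff_mem_nhds.1 hx)
    have hpos := hp.pos x hx
    obtain ⟨δ, hδ, hball⟩ := Metric.eventually_nhds_iff_ball.1
      (hcont.eventually (lt_mem_nhds (half_lt_self hpos)))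
    -- By continuity the density exceeds half its value at x on a small ball.
    refine ⟨δ, hδ, p x / 2, half_pos hpos, fun S hS hSm => ?_⟩
    rw [hmap, withDensity_apply _ hSm, ← setLIntegral_const]
    exact setLIntegral_mono' hSm fun y hy => ENNReal.ofReal_le_ofReal (hball y (hS hy)).le
  have hopen : ∀ O ⊆ interior 𝕏, IsOpen O → (P.map X) O = 0 → O = ∅ := by
    intro O hO hOo hnull
    by_contra hne
    obtain ⟨x, hx⟩ := nonempty_iff_ne_empty.2 hne
    obtain ⟨δ, hδ, c, hc, hlow⟩ := hlow x (hO hx)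
    have hU : IsOpen (Metric.ball x δ ∩ O) := Metric.isOpen_ball.inter hOo
    have hle := (hlow _ inter_subset_left hU.measurableSet).trans
      ((measure_mono inter_subset_right).trans hnull.le)
    have hv := hU.measure_pos volume ⟨x, Metric.mem_ball_self hδ, hx⟩
    exact absurd hle (not_le.2 (ENNReal.mul_pos (ENNReal.ofReal_pos.2 hc).ne' hv.ne'))
  have hz : ∀ x ∈ 𝕏, normalHeight Γ ℓ (projIndex Γ ℓ x) x = 0 := fun x hx =>
    normalHeight_projIndex_eq_zero h h𝕏 hd hopen h0 h1 hx
  refine ⟨h, hprob, hi, hself, ?_, ?_, ?_, ?_⟩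
  · filter_upwards [hmem] with x hx s hs
    exact projIndex_lt_iff h hN hg.injOn hz hx hs
  · intro s hs
    rw [measure_eq_zero_iff_ae_notMem]
    filter_upwards [hmem, measure_eq_zero_iff_ae_notMem.1 (hplane s hs)] with x hx hx0 hxs
    have := hz x hx
    rw [show projIndex Γ ℓ x = s from hxs] at this
    exact hx0 this
  · intro R hR
    rw [hmap]
    exact map_withDensity_of_comp_eq R (hsym.comp_eq R hR)
  · intro s hs
    obtain ⟨x, hx, hxs⟩ := exists_projIndex_eq h h𝕏 hd hmaps hs
    refine ⟨x, ?_, hlow x hx⟩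
    rw [← hxs]
    exact hz x (interior_subset hx)

/-! ### Reflections preserving the axis -/

/-- For w = 0 the formula reads R = id, so no nonvanishing assumption is needed. -/
theorem exists_reflection {w : EuclideanSpace ℝ (Fin (n + 1))} (hw : w (Fin.last n) = 0) :
    ∃ R : EuclideanSpace ℝ (Fin (n + 1)) ≃ₗᵢ[ℝ] EuclideanSpace ℝ (Fin (n + 1)),
      (∀ x, R x (Fin.last n) = x (Fin.last n)) ∧
      ∀ x, R x = x - (2 * (inner ℝ w x / ‖w‖ ^ 2)) • w := by
  have hR : ∀ x, (ℝ ∙ w)ᗮ.reflection x = x - (2 * (inner ℝ w x / ‖w‖ ^ 2)) • w := by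
    intro x
    rw [Submodule.reflection_orthogonal_apply, Submodule.reflection_singleton_apply]
    simp only [neg_sub, mul_smul, two_smul]
    simp
  refine ⟨(ℝ ∙ w)ᗮ.reflection, fun x => ?_, hR⟩
  rw [hR]
  simp [hw]

theorem exists_isometry_map {z x : EuclideanSpace ℝ (Fin (n + 1))} (hzx : ‖z‖ = ‖x‖)
    (hlast : z (Fin.last n) = x (Fin.last n)) :
    ∃ R : EuclideanSpace ℝ (Fin (n + 1)) ≃ₗᵢ[ℝ] EuclideanSpace ℝ (Fin (n + 1)),
      (∀ y, R y (Fin.last n) = y (Fin.last n)) ∧ R z = x := by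
  have hw : (z - x) (Fin.last n) = 0 := by simp [hlast]
  refine ⟨(ℝ ∙ (z - x))ᗮ.reflection, fun y => ?_, Submodule.reflection_sub hzx⟩
  rw [Submodule.reflection_orthogonal_apply, Submodule.reflection_singleton_apply]
  have : z (Fin.last n) - x (Fin.last n) = 0 := by simp [hlast]
  simp [this]

/-- The component of `v` orthogonal to the last coordinate axis. -/
noncomputable def horizontal (v : EuclideanSpace ℝ (Fin (n + 1))) :
    EuclideanSpace ℝ (Fin (n + 1)) :=
  v - v (Fin.last n) • EuclideanSpace.single (Fin.last n) 1

theorem horizontal_last (v : EuclideanSpace ℝ (Fin (n + 1))) :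
    horizontal v (Fin.last n) = 0 := by
  simp [horizontal]

theorem inner_horizontal {w : EuclideanSpace ℝ (Fin (n + 1))} (hw : w (Fin.last n) = 0)
    (v : EuclideanSpace ℝ (Fin (n + 1))) : inner ℝ w (horizontal v) = inner ℝ w v := by
  simp [horizontal, inner_sub_right, inner_smul_right, EuclideanSpace.inner_single_right, hw]

theorem inner_horizontal_self (v : EuclideanSpace ℝ (Fin (n + 1))) :
    inner ℝ (horizontal v) v = ‖horizontal v‖ ^ 2 := by
  rw [← inner_horizontal (horizontal_last v), real_inner_self_eq_norm_sq]

theorem norm_horizontal_le (v : EuclideanSpace ℝ (Fin (n + 1))) : ‖horizontal v‖ ≤ ‖v‖ := by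
  have h1 := inner_horizontal_self v
  have h2 := real_inner_le_norm (horizontal v) v
  by_contra hlt
  have := norm_nonneg v
  nlinarith

theorem continuous_horizontal :
    Continuous (horizontal : EuclideanSpace ℝ (Fin (n + 1)) → EuclideanSpace ℝ (Fin (n + 1))) := by
  unfold horizontal
  fun_prop

/-! ### Volume of slabs -/

/-- A ball of radius δ/16 about (δ/8)v, compressed by the factor t along v and translated by z + av,
fits into the slab. The compression is a transvection of determinant t. -/
theorem volume_slab_ge {v : EuclideanSpace ℝ (Fin (n + 1))} (hv : ‖v‖ = 1)
    (z : EuclideanSpace ℝ (Fin (n + 1))) {δ a t : ℝ} (hδ : 0 < δ) (ha : |a| ≤ δ / 4)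
    (ht : 0 < t) (ht1 : t ≤ 1) :
    ENNReal.ofReal t * volume (Metric.ball (0 : EuclideanSpace ℝ (Fin (n + 1))) (δ / 16)) ≤
      volume {x | x ∈ Metric.ball z δ ∧ a < inner ℝ (x - z) v ∧
        inner ℝ (x - z) v < a + t * (δ / 4)} := by
  let L : EuclideanSpace ℝ (Fin (n + 1)) →ₗ[ℝ] EuclideanSpace ℝ (Fin (n + 1)) :=
    LinearMap.transvection (innerₗ _ v) ((t - 1) • v)
  have hL : ∀ x, L x = x + inner ℝ v x • ((t - 1) • v) := fun x => rfl
  have hdet : LinearMap.det L = t := by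
    simp [L, LinearMap.transvection.det, hv]
  have hvv : inner ℝ v v = (1 : ℝ) := by simp [hv]
  have hvol := Measure.addHaar_image_linearMap volume L (Metric.ball ((δ / 8) • v) (δ / 16))
  rw [hdet, abs_of_pos ht, Measure.addHaar_ball_center,
    ← measure_preimage_add volume (-(z + a • v))] at hvol
  rw [← hvol]
  refine measure_mono fun x hx => ?_
  obtain ⟨y, hy, hyx⟩ := hx
  replace hyx : x = z + a • v + L y := by
    rw [hyx]
    module
  rw [Metric.mem_ball, dist_eq_norm] at hy
  have hyv : |inner ℝ (y - (δ / 8) • v) v| < δ / 16 :=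
    (abs_real_inner_le_norm _ _).trans_lt (by rwa [hv, mul_one])
  rw [inner_sub_left, real_inner_smul_left, hvv, mul_one, abs_lt] at hyv
  have hny : ‖y‖ < δ / 4 := by
    have h1 := norm_add_le (y - (δ / 8) • v) ((δ / 8) • v)
    rw [sub_add_cancel, norm_smul, hv, Real.norm_eq_abs, abs_of_pos (by positivity)] at h1
    linarith
  have hin : inner ℝ (x - z) v = a + t * inner ℝ y v := by
    rw [hyx, hL, show z + a • v + (y + inner ℝ v y • ((t - 1) • v)) - z =
      a • v + y + inner ℝ v y • ((t - 1) • v) by abel]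
    simp only [inner_add_left, real_inner_smul_left, hvv, real_inner_comm y v]
    ring
  refine ⟨?_, ?_, ?_⟩
  · rw [Metric.mem_ball, dist_eq_norm, hyx, hL,
      show z + a • v + (y + inner ℝ v y • ((t - 1) • v)) - z =
      a • v + (y + inner ℝ v y • ((t - 1) • v)) by abel]
    have h1 := norm_add_le (a • v) (y + inner ℝ v y • ((t - 1) • v))
    have h2 := norm_add_le y (inner ℝ v y • ((t - 1) • v))
    have h3 : ‖a • v‖ ≤ δ / 4 := by rwa [norm_smul, hv, mul_one]
    have h4 : ‖inner ℝ v y • ((t - 1) • v)‖ ≤ 3 * δ / 16 := by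
      rw [norm_smul, norm_smul, hv, mul_one, Real.norm_eq_abs, Real.norm_eq_abs,
        real_inner_comm, abs_of_pos (by linarith), abs_of_nonpos (by linarith)]
      nlinarith
    linarith
  · rw [hin]
    nlinarith
  · rw [hin]
    nlinarith

/-! ### Partial means -/

/-- The integral of `x` over the points whose projection index is less than `s`. -/
noncomputable def partialMean (m : Measure (EuclideanSpace ℝ (Fin (n + 1))))
    (Γ : ℝ → EuclideanSpace ℝ (Fin (n + 1))) (ℓ s : ℝ) : EuclideanSpace ℝ (Fin (n + 1)) :=
  ∫ x in projIndex Γ ℓ ⁻¹' Iio s, x ∂m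

namespace SymmetricPrincipalLaw

theorem inner_partialMean (hM : SymmetricPrincipalLaw m Γ ℓ) {s : ℝ} (hs : s ∈ Icc 0 ℓ)
    (w : EuclideanSpace ℝ (Fin (n + 1))) :
    inner ℝ w (partialMean m Γ ℓ s) =
      ∫ x, {x | normalHeight Γ ℓ s x < 0}.indicator (fun x => inner ℝ w x) x ∂m := by
  have hS : MeasurableSet (projIndex Γ ℓ ⁻¹' Iio s) :=
    measurable_projIndex hM.curve measurableSet_Iio
  rw [partialMean, ← integral_inner hM.integrable.integrableOn, ← integral_indicator hS]
  refine integral_congr_ae ?_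
  filter_upwards [hM.lt_iff] with x hx
  by_cases h : projIndex Γ ℓ x < s
  · rw [indicator_of_mem (show x ∈ projIndex Γ ℓ ⁻¹' Iio s from h),
      indicator_of_mem (show x ∈ {x | normalHeight Γ ℓ s x < 0} from (hx s hs).1 h)]
  · rw [indicator_of_notMem (show x ∉ projIndex Γ ℓ ⁻¹' Iio s from h),
      indicator_of_notMem (show x ∉ {x | normalHeight Γ ℓ s x < 0} from
        fun h' => h ((hx s hs).2 h'))]

theorem integral_comp_isometry (hM : SymmetricPrincipalLaw m Γ ℓ)
    {R : EuclideanSpace ℝ (Fin (n + 1)) ≃ₗᵢ[ℝ] EuclideanSpace ℝ (Fin (n + 1))}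
    (hR : ∀ x, R x (Fin.last n) = x (Fin.last n)) (G : EuclideanSpace ℝ (Fin (n + 1)) → ℝ) :
    ∫ x, G (R x) ∂m = ∫ x, G x ∂m :=
  MeasurePreserving.integral_comp ⟨R.continuous.measurable, hM.map_eq R hR⟩
    R.toHomeomorph.measurableEmbedding G

theorem measurable_normalHeight (s : ℝ) : Measurable (normalHeight Γ ℓ s) := by
  unfold normalHeight
  fun_prop

/-- The reflection along w preserves the law and the half-space but reverses the sign of w · x. -/
theorem inner_partialMean_eq_zero (hM : SymmetricPrincipalLaw m Γ ℓ) {s : ℝ} (hs : s ∈ Icc 0 ℓ)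
    {w : EuclideanSpace ℝ (Fin (n + 1))} (hw : w (Fin.last n) = 0)
    (hwt : inner ℝ w (tangent Γ ℓ s) = 0) : inner ℝ w (partialMean m Γ ℓ s) = 0 := by
  rcases eq_or_ne w 0 with rfl | hw0
  · simp
  obtain ⟨R, hR, hRx⟩ := exists_reflection hw
  have hnorm : ‖w‖ ^ 2 ≠ 0 := by positivity
  have h1 : ∀ x, normalHeight Γ ℓ s (R x) = normalHeight Γ ℓ s x := by
    intro x
    simp only [normalHeight, hRx, inner_sub_left, real_inner_smul_left, hwt]
    ring
  have h2 : ∀ x, inner ℝ w (R x) = -inner ℝ w x := by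
    intro x
    rw [hRx, inner_sub_right, inner_smul_right, real_inner_self_eq_norm_sq]
    field_simp
    ring
  rw [hM.inner_partialMean hs]
  have h3 := hM.integral_comp_isometry hR
    ({x | normalHeight Γ ℓ s x < 0}.indicator fun x => inner ℝ w x)
  have h4 : ∀ x, {x | normalHeight Γ ℓ s x < 0}.indicator (fun x => inner ℝ w x) (R x) =
      -{x | normalHeight Γ ℓ s x < 0}.indicator (fun x => inner ℝ w x) x := by
    intro x
    simp only [indicator, mem_ofPred_eq, h1, h2]
    split_ifs <;> simp
  simp only [h4, integral_neg] at h3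
  linarith

/-- Let w be the horizontal part of the tangent. Averaging over the reflection along w turns -2 w ·
I(s) into the integral of |w · x| over the points lying in exactly one of the half-space and its
mirror image. The conditions on S place it in that difference, on the side chosen by σ. -/
theorem mul_measureReal_le_inner_partialMean (hM : SymmetricPrincipalLaw m Γ ℓ) {s : ℝ}
    (hs : s ∈ Icc 0 ℓ) {S : Set (EuclideanSpace ℝ (Fin (n + 1)))} (hS : MeasurableSet S)
    {a σ : ℝ} (hσ : σ = 1 ∨ σ = -1)
    (hpos : ∀ x ∈ S, 0 < σ * normalHeight Γ ℓ s x)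
    (hlt : ∀ x ∈ S, σ * normalHeight Γ ℓ s x < 2 * (σ * inner ℝ (horizontal (tangent Γ ℓ s)) x))
    (hle : ∀ x ∈ S, a ≤ σ * inner ℝ (horizontal (tangent Γ ℓ s)) x) :
    a * m.real S ≤ 2 * -inner ℝ (horizontal (tangent Γ ℓ s)) (partialMean m Γ ℓ s) := by
  have := hM.prob
  set w := horizontal (tangent Γ ℓ s) with hwdef
  set f := normalHeight Γ ℓ s with hf
  obtain ⟨R, hR, hRx⟩ := exists_reflection (horizontal_last (tangent Γ ℓ s))
  rw [← hwdef] at hRx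
  have h1 : ∀ x, f (R x) = f x - 2 * inner ℝ w x := by
    intro x
    simp only [hf, normalHeight, hRx, inner_sub_left, real_inner_smul_left]
    rw [hwdef, inner_horizontal_self, ← hwdef]
    rcases eq_or_ne w 0 with h0 | h0
    · simp [h0]
    · have hnorm : ‖w‖ ^ 2 ≠ 0 := by positivity
      field_simp
      ring
  have h2 : ∀ x, inner ℝ w (R x) = -inner ℝ w x := by
    intro x
    rw [hRx, inner_sub_right, inner_smul_right, real_inner_self_eq_norm_sq]
    rcases eq_or_ne w 0 with h0 | h0
    · simp [h0]
    · have hnorm : ‖w‖ ^ 2 ≠ 0 := by positivity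
      field_simp
      ring
  let G : EuclideanSpace ℝ (Fin (n + 1)) → ℝ := {x | f x < 0}.indicator fun x => inner ℝ w x
  have hG : Integrable G m :=
    (hM.integrable.const_inner w).indicator
      (measurableSet_lt (measurable_normalHeight s) measurable_const)
  have hGR : Integrable (fun x => G (R x)) m :=
    MeasurePreserving.integrable_comp_of_integrable ⟨R.continuous.measurable, hM.map_eq R hR⟩ hG
  have h3 : ∫ x, (-G x - G (R x)) ∂m = 2 * -inner ℝ w (partialMean m Γ ℓ s) := by
    rw [integral_sub hG.fun_neg hGR, integral_neg, hM.integral_comp_isometry hR,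
      hM.inner_partialMean hs]
    ring
  rw [← h3]
  have h4 : ∫ x, S.indicator (fun _ => a) x ∂m = a * m.real S := by
    rw [integral_indicator hS, setIntegral_const, smul_eq_mul, mul_comm]
  rw [← h4]
  refine integral_mono ((integrable_const a).indicator hS) (hG.fun_neg.sub hGR) fun x => ?_
  -- This integrand is nonnegative everywhere: the two terms cancel unless f x and f x - 2 w · x lie
  -- on different sides of 0.
  have h5 : -G x - G (R x) = (if f x < 0 then -inner ℝ w x else 0) +
      if f x < 2 * inner ℝ w x then inner ℝ w x else 0 := by
    simp only [G, indicator, mem_ofPred_eq, h1, h2, sub_neg]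
    split_ifs <;> ring
  rw [h5]
  by_cases hx : x ∈ S
  · rw [indicator_of_mem hx]
    have e1 := hpos x hx
    have e2 := hlt x hx
    have e3 := hle x hx
    rcases hσ with rfl | rfl
    · rw [if_neg (by linarith), if_pos (by linarith)]
      linarith
    · rw [if_pos (by linarith), if_neg (by linarith)]
      linarith
  · rw [indicator_of_notMem hx]
    split_ifs <;> linarith

end SymmetricPrincipalLaw

/-! ### Coercivity: the partial mean controls the horizontal tangent -/

namespace IsSmoothJordanCurve

theorem continuousAt_tangent (h : IsSmoothJordanCurve Γ ℓ) {s : ℝ} (hs : s ∈ Ioo 0 ℓ) :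
    ContinuousAt (tangent Γ ℓ) s :=
  h.continuousOn_tangent.continuousAt (Icc_mem_nhds hs.1 hs.2)

theorem continuousAt_normalHeight (h : IsSmoothJordanCurve Γ ℓ) {s : ℝ} (hs : s ∈ Ioo 0 ℓ)
    (x : EuclideanSpace ℝ (Fin (n + 1))) :
    ContinuousAt (fun q : ℝ × EuclideanSpace ℝ (Fin (n + 1)) => normalHeight Γ ℓ q.1 q.2) (s, x) := by
  have hS : Icc 0 ℓ ×ˢ (univ : Set (EuclideanSpace ℝ (Fin (n + 1)))) ∈ 𝓝 (s, x) :=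
    prod_mem_nhds (Icc_mem_nhds hs.1 hs.2) univ_mem
  exact (continuousOn_normalHeight h continuousOn_fst continuousOn_snd
    fun q hq => hq.1).continuousAt hS

end IsSmoothJordanCurve

namespace SymmetricPrincipalLaw

theorem norm_horizontal_tangent_le (hM : SymmetricPrincipalLaw m Γ ℓ) {s : ℝ} (hs : s ∈ Icc 0 ℓ) :
    ‖horizontal (tangent Γ ℓ s)‖ ≤ 1 :=
  (norm_horizontal_le _).trans (hM.curve.arcLength s hs).le

/-- When the tangent at s₀ is not vertical, one fixed open set of positive mass lies between the
half-space and its mirror image for all s near s₀. -/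
theorem exists_coercive_of_ne_zero (hM : SymmetricPrincipalLaw m Γ ℓ) {s₀ : ℝ}
    (hs₀ : s₀ ∈ Ioo 0 ℓ) (hne : horizontal (tangent Γ ℓ s₀) ≠ 0) :
    ∃ c > 0, ∀ᶠ s in 𝓝 s₀, c * ‖horizontal (tangent Γ ℓ s)‖ ^ 2 ≤
      -inner ℝ (horizontal (tangent Γ ℓ s)) (partialMean m Γ ℓ s) := by
  have := hM.prob
  obtain ⟨x₀, hx₀, δ, hδ, c, hc, hlow⟩ := hM.slice s₀ hs₀
  set w := horizontal (tangent Γ ℓ s₀) with hw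
  have hwn : 0 < ‖w‖ := norm_pos_iff.2 hne
  obtain ⟨σ, hσ, hσx⟩ : ∃ σ : ℝ, (σ = 1 ∨ σ = -1) ∧ 0 ≤ σ * inner ℝ w x₀ := by
    rcases le_total 0 (inner ℝ w x₀) with h | h
    · exact ⟨1, Or.inl rfl, by linarith⟩
    · exact ⟨-1, Or.inr rfl, by linarith⟩
  have hσ2 : σ * σ = 1 := by rcases hσ with rfl | rfl <;> norm_num
  obtain ⟨ε, hε, hεδ⟩ : ∃ ε > 0, ε / ‖w‖ < δ :=
    -- Moving x₀ by ε/‖w‖ along σw stays in the ball, makes σ · height equal to ε, and raises σ(w ·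
    -- x) to at least ε. Thus 0 < ε < 2ε gives strict inequalities, which are stable under
    -- perturbation.
    ⟨δ * ‖w‖ / 2, by positivity, by field_simp; linarith⟩
  set x₁ := x₀ + (σ * (ε / ‖w‖ ^ 2)) • w with hx₁
  have hx₁δ : x₁ ∈ Metric.ball x₀ δ := by
    rw [Metric.mem_ball, dist_eq_norm, hx₁, add_sub_cancel_left, norm_smul, norm_mul,
      Real.norm_eq_abs, Real.norm_eq_abs, abs_of_pos (show 0 < ε / ‖w‖ ^ 2 by positivity)]
    have : |σ| = 1 := by rcases hσ with rfl | rfl <;> simp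
    rw [this, one_mul]
    convert! hεδ using 1
    field_simp
  have hf₁ : normalHeight Γ ℓ s₀ x₁ = σ * ε := by
    rw [normalHeight, hx₁, add_sub_right_comm, inner_add_left, real_inner_smul_left,
      inner_horizontal_self, ← hw, show inner ℝ (x₀ - Γ s₀) (tangent Γ ℓ s₀) = 0 from hx₀]
    field_simp
    ring
  have hτ₁ : σ * inner ℝ w x₁ = σ * inner ℝ w x₀ + ε := by
    rw [hx₁, inner_add_right, inner_smul_right, real_inner_self_eq_norm_sq]
    field_simp
    linear_combination ε * hσ2
  have hcf : ContinuousAt (fun q : ℝ × EuclideanSpace ℝ (Fin (n + 1)) =>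
      σ * normalHeight Γ ℓ q.1 q.2) (s₀, x₁) :=
    (hM.curve.continuousAt_normalHeight hs₀ x₁).const_mul σ
  have hcτ : ContinuousAt (fun q : ℝ × EuclideanSpace ℝ (Fin (n + 1)) =>
      σ * inner ℝ (horizontal (tangent Γ ℓ q.1)) q.2) (s₀, x₁) := by
    have h1 : ContinuousAt (fun q : ℝ × EuclideanSpace ℝ (Fin (n + 1)) =>
        horizontal (tangent Γ ℓ q.1)) (s₀, x₁) :=
      continuous_horizontal.continuousAt.comp
        ((hM.curve.continuousAt_tangent hs₀).comp (x := (s₀, x₁)) continuousAt_fst)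
    exact (h1.inner continuousAt_snd).const_mul σ
  have hσf : σ * normalHeight Γ ℓ s₀ x₁ = ε := by rw [hf₁]; linear_combination ε * hσ2
  have hev : ∀ᶠ q : ℝ × EuclideanSpace ℝ (Fin (n + 1)) in 𝓝 (s₀, x₁),
      0 < σ * normalHeight Γ ℓ q.1 q.2 ∧
      σ * normalHeight Γ ℓ q.1 q.2 < 2 * (σ * inner ℝ (horizontal (tangent Γ ℓ q.1)) q.2) ∧
      ε / 2 < σ * inner ℝ (horizontal (tangent Γ ℓ q.1)) q.2 := by
    refine (hcf.eventually (lt_mem_nhds (a := 0) ?_)).and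
      ((hcf.eventually_lt (hcτ.const_mul 2) ?_).and
        (hcτ.eventually (lt_mem_nhds (a := ε / 2) ?_)))
    · simp only [hσf, hε]
    · simp only [hσf, ← hw, hτ₁]
      linarith
    · simp only [← hw, hτ₁]
      linarith
  rw [nhds_prod_eq, eventually_prod_iff] at hev
  obtain ⟨pa, hpa, pb, hpb, hab⟩ := hev
  obtain ⟨U, hUpb, hUo, hxU⟩ := mem_nhds_iff.1 (inter_mem hpb (Metric.isOpen_ball.mem_nhds hx₁δ))
  have hmU : 0 < m.real U := by
    refine ENNReal.toReal_pos (ne_of_gt (lt_of_lt_of_le ?_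
      (hlow U (fun x hx => (hUpb hx).2) hUo.measurableSet))) (measure_ne_top _ _)
    exact ENNReal.mul_pos (ENNReal.ofReal_pos.2 hc).ne' (hUo.measure_pos volume ⟨x₁, hxU⟩).ne'
  refine ⟨ε / 4 * m.real U, by positivity, ?_⟩
  filter_upwards [hpa, Icc_mem_nhds hs₀.1 hs₀.2] with s hs hsI
  have hq : ∀ x ∈ U, _ := fun x hx => hab hs (hUpb hx).1
  have key := hM.mul_measureReal_le_inner_partialMean hsI hUo.measurableSet hσ
    (fun x hx => (hq x hx).1) (fun x hx => (hq x hx).2.1) (fun x hx => (hq x hx).2.2.le)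
  have h1 : ‖horizontal (tangent Γ ℓ s)‖ ^ 2 ≤ 1 :=
    pow_le_one₀ (norm_nonneg _) (hM.norm_horizontal_tangent_le hsI)
  have h2 : ε / 4 * m.real U * ‖horizontal (tangent Γ ℓ s)‖ ^ 2 ≤ ε / 4 * m.real U :=
    mul_le_of_le_one_right (by positivity) h1
  linarith

theorem mul_volume_le_of_isometry (hM : SymmetricPrincipalLaw m Γ ℓ)
    {x z : EuclideanSpace ℝ (Fin (n + 1))} {δ c : ℝ}
    (hlow : ∀ S ⊆ Metric.ball x δ, MeasurableSet S → ENNReal.ofReal c * volume S ≤ m S)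
    {R : EuclideanSpace ℝ (Fin (n + 1)) ≃ₗᵢ[ℝ] EuclideanSpace ℝ (Fin (n + 1))}
    (hR : ∀ y, R y (Fin.last n) = y (Fin.last n)) (hRz : R z = x)
    {S : Set (EuclideanSpace ℝ (Fin (n + 1)))} (hS : S ⊆ Metric.ball z δ)
    (hSm : MeasurableSet S) : ENNReal.ofReal c * volume S ≤ m S := by
  have hR' : ∀ y, R.symm y (Fin.last n) = y (Fin.last n) := fun y => by
    rw [← hR (R.symm y), R.apply_symm_apply]
  have hms : Measurable R.symm := R.symm.continuous.measurable
  have h1 := hlow (R.symm ⁻¹' S) (fun y hy => by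
    have := hS hy
    rw [Metric.mem_ball, ← R.dist_map, R.apply_symm_apply, hRz] at this
    exact this) (hms hSm)
  rwa [R.symm.measurePreserving.measure_preimage hSm.nullMeasurableSet,
    ← Measure.map_apply hms hSm, hM.map_eq R.symm hR'] at h1

/-- Near a vertical tangent the two half-spaces nearly coincide. For a point z at distance ρ from
the axis whose horizontal part points along w, they differ near z in a slab of thickness of order
‖w‖, on which w · y is of order ρ‖w‖; the product gives ‖w‖². Symmetry lets z depend on s while the
density bound near z stays that of one fixed point x. -/
theorem exists_coercive_of_eq_zero (hn : 2 ≤ n) (hM : SymmetricPrincipalLaw m Γ ℓ) {s₀ : ℝ}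
    (hs₀ : s₀ ∈ Ioo 0 ℓ) (hzero : horizontal (tangent Γ ℓ s₀) = 0) :
    ∃ c > 0, ∀ᶠ s in 𝓝 s₀, c * ‖horizontal (tangent Γ ℓ s)‖ ^ 2 ≤
      -inner ℝ (horizontal (tangent Γ ℓ s)) (partialMean m Γ ℓ s) := by
  have := hM.prob
  obtain ⟨x₀, hx₀, δ₀, hδ₀, c, hc, hlow₀⟩ := hM.slice s₀ hs₀
  obtain ⟨x, hx, hρ, δ₁, hδ₁, hlow⟩ : ∃ x, normalHeight Γ ℓ s₀ x = 0 ∧ 0 < ‖horizontal x‖ ∧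
      ∃ δ > 0, ∀ S ⊆ Metric.ball x δ, MeasurableSet S → ENNReal.ofReal c * volume S ≤ m S := by
    -- A point on the axis is moved off it within its slice, which is horizontal here.
    by_cases h0 : horizontal x₀ = 0
    · let e : EuclideanSpace ℝ (Fin (n + 1)) := EuclideanSpace.single 0 1
      have he : e (Fin.last n) = 0 := by
        have : Fin.last n ≠ 0 := by
          rw [Ne, Fin.ext_iff]
          simp
          omega
        simp [e, this]
      have hen : ‖e‖ = 1 := by simp [e]
      have het : inner ℝ e (tangent Γ ℓ s₀) = 0 := by
        rw [← inner_horizontal he, hzero, inner_zero_right]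
      refine ⟨x₀ + (δ₀ / 2) • e, ?_, ?_, δ₀ / 2, by positivity, fun S hS hSm => hlow₀ S
        (hS.trans (Metric.ball_subset_ball' ?_)) hSm⟩
      · rw [normalHeight, add_sub_right_comm, inner_add_left, real_inner_smul_left, het,
          show inner ℝ (x₀ - Γ s₀) (tangent Γ ℓ s₀) = 0 from hx₀]
        simp
      · have : horizontal (x₀ + (δ₀ / 2) • e) = horizontal x₀ + (δ₀ / 2) • e := by
          simp only [horizontal, PiLp.add_apply, PiLp.smul_apply, he, smul_zero, add_zero]
          abel
        rw [this, h0, zero_add, norm_smul, hen, mul_one]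
        simpa using hδ₀.ne'
      · rw [dist_eq_norm, add_sub_cancel_left, norm_smul, hen, mul_one, Real.norm_eq_abs,
          abs_of_pos (by positivity)]
        linarith
    · exact ⟨x₀, hx₀, norm_pos_iff.2 h0, δ₀, hδ₀, hlow₀⟩
  set ρ := ‖horizontal x‖ with hρdef
  let e : EuclideanSpace ℝ (Fin (n + 1)) := EuclideanSpace.single (Fin.last n) 1
  obtain ⟨δ, hδ, hδδ₁, hδρ⟩ : ∃ δ > 0, δ ≤ δ₁ ∧ δ ≤ ρ / 2 :=
    ⟨min δ₁ (ρ / 2), lt_min hδ₁ (by positivity), min_le_left _ _, min_le_right _ _⟩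
  have hxe : x = horizontal x + x (Fin.last n) • e := by simp [horizontal, e]
  have hdecomp : ∀ v : EuclideanSpace ℝ (Fin (n + 1)), v (Fin.last n) = 0 → ∀ r : ℝ,
      ‖v + r • e‖ ^ 2 = ‖v‖ ^ 2 + r ^ 2 := by
    intro v hv r
    rw [norm_add_sq_real, inner_smul_right, EuclideanSpace.inner_single_right, hv, norm_smul]
    simp [e]
  -- The height of the rotated point z, written without the direction w/‖w‖ so that it stays
  -- continuous where w vanishes.
  let F : ℝ → ℝ := fun s => ρ * ‖horizontal (tangent Γ ℓ s)‖ +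
    x (Fin.last n) * inner ℝ e (tangent Γ ℓ s) - inner ℝ (Γ s) (tangent Γ ℓ s)
  have hF0 : F s₀ = 0 := by
    have : inner ℝ x (tangent Γ ℓ s₀) = x (Fin.last n) * inner ℝ e (tangent Γ ℓ s₀) := by
      conv_lhs => rw [hxe]
      rw [inner_add_left, real_inner_smul_left, ← inner_horizontal (horizontal_last x), hzero,
        inner_zero_right, zero_add]
    rw [normalHeight, inner_sub_left, this] at hx
    simp only [F, hzero, norm_zero, mul_zero, zero_add]
    exact hx
  have hFc : ContinuousAt F s₀ := by
    have ht := hM.curve.continuousAt_tangent hs₀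
    have hΓ := (hM.curve.hasDerivAt hs₀).continuousAt
    exact ((continuousAt_const.mul (continuous_horizontal.continuousAt.comp ht).norm).add
      (continuousAt_const.mul (continuousAt_const.inner ht))).sub (hΓ.inner ht)
  have hFs : ∀ᶠ s in 𝓝 s₀, |F s| < δ / 4 :=
    hFc.abs.eventually (gt_mem_nhds (by simp only [hF0, abs_zero]; positivity))
  set V := volume (Metric.ball (0 : EuclideanSpace ℝ (Fin (n + 1))) (δ / 16)) with hV
  have hVpos : 0 < V.toReal :=
    ENNReal.toReal_pos (Metric.measure_ball_pos volume _ (by positivity)).ne'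
      (measure_ball_lt_top).ne
  refine ⟨ρ * c * V.toReal / 4, by positivity, ?_⟩
  filter_upwards [hFs, Icc_mem_nhds hs₀.1 hs₀.2] with s hs hsI
  set w := horizontal (tangent Γ ℓ s) with hw
  rcases eq_or_ne w 0 with h0 | h0
  · simp [h0]
  have hwn : 0 < ‖w‖ := norm_pos_iff.2 h0
  have hw1 : ‖w‖ ≤ 1 := hM.norm_horizontal_tangent_le hsI
  have hwl : w (Fin.last n) = 0 := horizontal_last _
  set z := (ρ / ‖w‖) • w + x (Fin.last n) • e with hz
  have hzl : z (Fin.last n) = x (Fin.last n) := by simp [hz, e, hwl]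
  have hznorm : ‖z‖ = ‖x‖ := by
    rw [← sq_eq_sq₀ (norm_nonneg _) (norm_nonneg _), hz, hdecomp _ (by simp [hwl])]
    conv_rhs => rw [hxe, hdecomp _ (horizontal_last x)]
    rw [norm_smul, Real.norm_eq_abs, abs_of_pos (by positivity), div_mul_cancel₀ _ hwn.ne']
  obtain ⟨R, hR, hRz⟩ := exists_isometry_map hznorm hzl
  have hfz : normalHeight Γ ℓ s z = F s := by
    rw [normalHeight, inner_sub_left, hz, inner_add_left, real_inner_smul_left,
      real_inner_smul_left, hw, inner_horizontal_self, ← hw]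
    simp only [F, ← hw]
    field_simp
  have hwz : inner ℝ w z = ρ * ‖w‖ := by
    rw [hz, inner_add_right, inner_smul_right, inner_smul_right, real_inner_self_eq_norm_sq,
      EuclideanSpace.inner_single_right, hwl]
    simp
    field_simp
  have hfx : ∀ y, normalHeight Γ ℓ s y = F s + inner ℝ (y - z) (tangent Γ ℓ s) := by
    intro y
    rw [← hfz]
    simp only [normalHeight, inner_sub_left]
    ring
  set S := {y | y ∈ Metric.ball z δ ∧ -F s < inner ℝ (y - z) (tangent Γ ℓ s) ∧
    inner ℝ (y - z) (tangent Γ ℓ s) < -F s + ‖w‖ * (δ / 4)} with hS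
  have hSm : MeasurableSet S := by
    have hin : Measurable fun y => inner ℝ (y - z) (tangent Γ ℓ s) := by fun_prop
    exact Metric.isOpen_ball.measurableSet.inter
      ((measurableSet_lt measurable_const hin).inter (measurableSet_lt hin measurable_const))
  -- The inner product at z is ρ‖w‖, and δ ≤ ρ/2 lets it drop by at most half on the ball.
  have hSτ : ∀ y ∈ S, ρ * ‖w‖ / 2 ≤ inner ℝ w y := by
    intro y hy
    have h1 : |inner ℝ w (y - z)| ≤ ‖w‖ * δ := (abs_real_inner_le_norm _ _).trans
      (mul_le_mul_of_nonneg_left (mem_ball_iff_norm.1 hy.1).le (norm_nonneg _))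
    rw [inner_sub_right, hwz] at h1
    have h2 := (abs_le.1 h1).1
    nlinarith
  have key := hM.mul_measureReal_le_inner_partialMean hsI hSm (Or.inl rfl) (a := ρ * ‖w‖ / 2)
    (fun y hy => by rw [hfx, one_mul]; linarith [hy.2.1])
    (fun y hy => by
      have h1 := hy.2.2
      have h2 := hSτ y hy
      rw [hfx, one_mul, one_mul]
      nlinarith)
    (fun y hy => by rw [one_mul]; exact hSτ y hy)
  have hvol := volume_slab_ge (hM.curve.arcLength s hsI) z hδ
    (a := -F s) (by rw [abs_neg]; exact hs.le) hwn hw1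
  have hmS := (mul_le_mul_right (a := ENNReal.ofReal c) hvol).trans
    (hM.mul_volume_le_of_isometry hlow hR hRz
    (fun y hy => Metric.ball_subset_ball hδδ₁ hy.1) hSm)
  have hmr : c * (‖w‖ * V.toReal) ≤ m.real S := by
    have := ENNReal.toReal_mono (measure_ne_top m S) hmS
    rwa [ENNReal.toReal_mul, ENNReal.toReal_mul, ENNReal.toReal_ofReal hc.le,
      ENNReal.toReal_ofReal hwn.le] at this
  have := mul_le_mul_of_nonneg_left hmr (show 0 ≤ ρ * ‖w‖ / 2 by positivity)
  nlinarith

/-- Horizontally I(s) is a multiple of the tangent's horizontal part y, so the bound on y · I(s)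
gives one for all horizontal w, with the same constant. -/
theorem exists_abs_inner_tangent_le (hn : 2 ≤ n) (hM : SymmetricPrincipalLaw m Γ ℓ) {s₀ : ℝ}
    (hs₀ : s₀ ∈ Ioo 0 ℓ) :
    ∃ c > 0, ∀ᶠ s in 𝓝 s₀, ∀ w : EuclideanSpace ℝ (Fin (n + 1)), w (Fin.last n) = 0 →
      c * |inner ℝ w (tangent Γ ℓ s)| ≤ |inner ℝ w (partialMean m Γ ℓ s)| := by
  obtain ⟨c, hc, hev⟩ : ∃ c > 0, ∀ᶠ s in 𝓝 s₀, c * ‖horizontal (tangent Γ ℓ s)‖ ^ 2 ≤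
      -inner ℝ (horizontal (tangent Γ ℓ s)) (partialMean m Γ ℓ s) := by
    by_cases h : horizontal (tangent Γ ℓ s₀) = 0
    · exact hM.exists_coercive_of_eq_zero hn hs₀ h
    · exact hM.exists_coercive_of_ne_zero hs₀ h
  refine ⟨c, hc, ?_⟩
  filter_upwards [hev, Icc_mem_nhds hs₀.1 hs₀.2] with s hs hsI w hw
  set y := horizontal (tangent Γ ℓ s) with hy
  have hyl : y (Fin.last n) = 0 := horizontal_last _
  rw [← inner_horizontal hw, ← hy]
  rcases eq_or_ne y 0 with h0 | h0
  · simp [h0]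
  have hyn : 0 < ‖y‖ ^ 2 := by positivity
  have h1 := hM.inner_partialMean_eq_zero hsI (w := w - (inner ℝ w y / ‖y‖ ^ 2) • y)
    (by simp [hw, hyl]) (by
      rw [inner_sub_left, real_inner_smul_left, hy, inner_horizontal_self, ← hy,
        ← inner_horizontal hw, ← hy]
      field_simp
      ring)
  rw [inner_sub_left, real_inner_smul_left, sub_eq_zero] at h1
  rw [h1, abs_mul, abs_div, abs_of_pos hyn, div_mul_eq_mul_div, le_div_iff₀ hyn]
  have h2 := hs.trans (neg_le_abs _)
  have := mul_le_mul_of_nonneg_left h2 (abs_nonneg (inner ℝ w y))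
  linarith

end SymmetricPrincipalLaw

/-- The distribution function of the projection index. -/
noncomputable def projCdf (m : Measure (EuclideanSpace ℝ (Fin (n + 1))))
    (Γ : ℝ → EuclideanSpace ℝ (Fin (n + 1))) (ℓ s : ℝ) : ℝ :=
  m.real (projIndex Γ ℓ ⁻¹' Iio s)

/-! ### Increments of the partial mean and the wedge identity -/

namespace SymmetricPrincipalLaw

theorem continuousAt_projCdf (hM : SymmetricPrincipalLaw m Γ ℓ) {s : ℝ} (hs : s ∈ Icc 0 ℓ) :
    ContinuousAt (projCdf m Γ ℓ) s := by
  have := hM.prob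
  have hmeas : ∀ r, MeasurableSet (projIndex Γ ℓ ⁻¹' Iio r) := fun r =>
    measurable_projIndex hM.curve measurableSet_Iio
  have heq : projCdf m Γ ℓ =
      fun r => ∫ x, (projIndex Γ ℓ ⁻¹' Iio r).indicator (fun _ => (1 : ℝ)) x ∂m := by
    funext r
    rw [integral_indicator (hmeas r), setIntegral_const, smul_eq_mul, mul_one]
    rfl
  rw [heq]
  refine continuousAt_of_dominated (bound := fun _ => 1)
    (Eventually.of_forall fun r => (aestronglyMeasurable_const.indicator (hmeas r)))
    (Eventually.of_forall fun r => Eventually.of_forall fun x => ?_) (integrable_const _) ?_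
  · simp only [indicator]
    split_ifs <;> simp
  · filter_upwards [measure_eq_zero_iff_ae_notMem.1 (hM.fiber_null s hs)] with x hx
    rcases lt_or_gt_of_ne (show projIndex Γ ℓ x ≠ s from hx) with h | h
    · refine continuousAt_const.congr (f := fun _ => (1 : ℝ)) ?_
      filter_upwards [lt_mem_nhds h] with r hr
      rw [indicator_of_mem (show x ∈ projIndex Γ ℓ ⁻¹' Iio r from hr)]
    · refine continuousAt_const.congr (f := fun _ => (0 : ℝ)) ?_
      filter_upwards [gt_mem_nhds h] with r hr
      rw [indicator_of_notMem (show x ∉ projIndex Γ ℓ ⁻¹' Iio r from not_lt.2 (le_of_lt hr))]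

theorem partialMean_zero (hM : SymmetricPrincipalLaw m Γ ℓ) : partialMean m Γ ℓ 0 = 0 := by
  have : projIndex Γ ℓ ⁻¹' Iio 0 = ∅ :=
    eq_empty_of_forall_notMem fun x hx => not_lt.2 (projIndex_mem hM.curve x).1 hx
  rw [partialMean, this, setIntegral_empty]

theorem measureReal_projIndex_Ico (hM : SymmetricPrincipalLaw m Γ ℓ) {s s' : ℝ} (hss' : s ≤ s') :
    m.real (projIndex Γ ℓ ⁻¹' Ico s s') = projCdf m Γ ℓ s' - projCdf m Γ ℓ s := by
  have := hM.prob
  have hdiff : projIndex Γ ℓ ⁻¹' Ico s s' =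
      projIndex Γ ℓ ⁻¹' Iio s' \ projIndex Γ ℓ ⁻¹' Iio s := by
    ext x
    simp [and_comm]
  rw [hdiff, measureReal_sdiff (preimage_mono (Iio_subset_Iio hss'))
    (measurable_projIndex hM.curve measurableSet_Iio)]
  rfl

/-- Self-consistency in the integrated form dI = Γ dF. -/
theorem partialMean_sub (hM : SymmetricPrincipalLaw m Γ ℓ) {s s' : ℝ} (hss' : s ≤ s') :
    partialMean m Γ ℓ s' - partialMean m Γ ℓ s =
      ∫ x in projIndex Γ ℓ ⁻¹' Ico s s', Γ (projIndex Γ ℓ x) ∂m := by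
  have hmeas := measurable_projIndex hM.curve
  rw [← hM.selfConsistent _ measurableSet_Ico, partialMean, partialMean, sub_eq_iff_eq_add,
    ← setIntegral_union _ (hmeas measurableSet_Iio) hM.integrable.integrableOn
      hM.integrable.integrableOn, ← preimage_union, union_comm, Iio_union_Ico_eq_Iio hss']
  refine Disjoint.preimage _ (disjoint_left.2 fun r hr hr' => ?_)
  exact not_lt.2 hr.1 hr'

theorem abs_inner_partialMean_sub_le (hM : SymmetricPrincipalLaw m Γ ℓ) {s s' C : ℝ}
    (hss' : s ≤ s') (w : EuclideanSpace ℝ (Fin (n + 1)))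
    (hC : ∀ r ∈ Icc 0 ℓ, r ∈ Icc s s' → |inner ℝ w (Γ r)| ≤ C) :
    |inner ℝ w (partialMean m Γ ℓ s' - partialMean m Γ ℓ s)| ≤
      C * (projCdf m Γ ℓ s' - projCdf m Γ ℓ s) := by
  have := hM.prob
  rw [hM.partialMean_sub hss', ← integral_inner
    (integrable_comp_projIndex hM.curve m).integrableOn, ← hM.measureReal_projIndex_Ico hss',
    ← Real.norm_eq_abs]
  exact norm_setIntegral_le_of_norm_le_const (measure_lt_top _ _) fun x hx =>
    hC _ (projIndex_mem hM.curve x) (Ico_subset_Icc_self hx)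

theorem projCdf_mono (hM : SymmetricPrincipalLaw m Γ ℓ) : Monotone (projCdf m Γ ℓ) :=
  fun s s' hss' => by
    have := hM.prob
    exact measureReal_mono (preimage_mono (Iio_subset_Iio hss'))

theorem projCdf_sub_le_one (hM : SymmetricPrincipalLaw m Γ ℓ) (s s' : ℝ) :
    projCdf m Γ ℓ s' - projCdf m Γ ℓ s ≤ 1 := by
  have := hM.prob
  have h1 : projCdf m Γ ℓ s' ≤ 1 := measureReal_le_one
  have h2 : 0 ≤ projCdf m Γ ℓ s := measureReal_nonneg
  linarith

theorem abs_inner_partialMean_sub_le_abs (hM : SymmetricPrincipalLaw m Γ ℓ) {s s' C : ℝ}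
    (w : EuclideanSpace ℝ (Fin (n + 1)))
    (hC : ∀ r ∈ Icc 0 ℓ, r ∈ uIcc s s' → |inner ℝ w (Γ r)| ≤ C) :
    |inner ℝ w (partialMean m Γ ℓ s' - partialMean m Γ ℓ s)| ≤
      C * |projCdf m Γ ℓ s' - projCdf m Γ ℓ s| := by
  rcases le_total s s' with h | h
  · rw [abs_of_nonneg (sub_nonneg.2 (hM.projCdf_mono h))]
    rw [uIcc_of_le h] at hC
    exact hM.abs_inner_partialMean_sub_le h w hC
  · rw [abs_of_nonpos (sub_nonpos.2 (hM.projCdf_mono h)), ← abs_neg, ← inner_neg_right]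
    rw [uIcc_of_ge h] at hC
    simpa using hM.abs_inner_partialMean_sub_le h w hC

theorem norm_sub_le (hM : SymmetricPrincipalLaw m Γ ℓ) {s s' : ℝ} (hs : s ∈ Icc 0 ℓ)
    (hs' : s' ∈ Icc 0 ℓ) : ‖Γ s' - Γ s‖ ≤ |s' - s| := by
  have := (convex_Icc 0 ℓ).norm_image_sub_le_of_norm_hasDerivWithin_le
    (fun r hr => hM.curve.hasDerivWithinAt hr) (fun r hr => (hM.curve.arcLength r hr).le) hs hs'
  simpa using this

theorem continuousOn_inner_partialMean (hM : SymmetricPrincipalLaw m Γ ℓ)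
    (w : EuclideanSpace ℝ (Fin (n + 1))) :
    ContinuousOn (fun s => inner ℝ w (partialMean m Γ ℓ s)) (Icc 0 ℓ) := by
  obtain ⟨C, hC⟩ := isCompact_Icc.exists_bound_of_continuousOn
    (f := fun s => (inner ℝ w (Γ s) : ℝ)) (continuousOn_const.inner hM.curve.continuousOn)
  intro s hs
  have hF : Tendsto (fun s' => C * |projCdf m Γ ℓ s' - projCdf m Γ ℓ s|) (𝓝 s) (𝓝 0) := by
    have := (((hM.continuousAt_projCdf hs).tendsto.sub_const (projCdf m Γ ℓ s)).abs).const_mul C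
    simpa using this
  refine ContinuousAt.continuousWithinAt (tendsto_iff_norm_sub_tendsto_zero.2 ?_)
  refine squeeze_zero (fun _ => norm_nonneg _) (fun s' => ?_) hF
  rw [← inner_sub_right]
  exact hM.abs_inner_partialMean_sub_le_abs w fun r hr _ => hC r hr

/-- The wedge product of the partial mean and the curve vanishes on horizontal vectors. -/
theorem wedge_partialMean_eq_zero (hM : SymmetricPrincipalLaw m Γ ℓ)
    {v w : EuclideanSpace ℝ (Fin (n + 1))} (hv : v (Fin.last n) = 0) (hw : w (Fin.last n) = 0)
    {s : ℝ} (hs : s ∈ Icc 0 ℓ) :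
    inner ℝ v (partialMean m Γ ℓ s) * inner ℝ w (Γ s) -
      inner ℝ w (partialMean m Γ ℓ s) * inner ℝ v (Γ s) = 0 := by
  set f : ℝ → ℝ := fun s => inner ℝ v (partialMean m Γ ℓ s) * inner ℝ w (Γ s) -
      inner ℝ w (partialMean m Γ ℓ s) * inner ℝ v (Γ s) with hf
  have hderiv : ∀ s ∈ Icc 0 ℓ, HasDerivWithinAt f 0 (Icc 0 ℓ) s := by
    intro s hs
    have hΓ : ∀ u : EuclideanSpace ℝ (Fin (n + 1)), HasDerivWithinAt
        (fun r => (inner ℝ u (Γ r) : ℝ)) (inner ℝ u (tangent Γ ℓ s)) (Icc 0 ℓ) s := fun u => by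
      simpa using (hasDerivWithinAt_const s (Icc 0 ℓ) u).inner ℝ (hM.curve.hasDerivWithinAt hs)
    -- With I frozen at s the derivative is I(s) ∧ Γ'(s), which is I(s) paired with a horizontal
    -- vector orthogonal to the tangent.
    have h1 : HasDerivWithinAt (fun r => inner ℝ v (partialMean m Γ ℓ s) * inner ℝ w (Γ r) -
        inner ℝ w (partialMean m Γ ℓ s) * inner ℝ v (Γ r)) 0 (Icc 0 ℓ) s := by
      have h := ((hΓ w).const_mul (inner ℝ v (partialMean m Γ ℓ s))).sub
        ((hΓ v).const_mul (inner ℝ w (partialMean m Γ ℓ s)))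
      have h0 := hM.inner_partialMean_eq_zero hs
        (w := inner ℝ w (tangent Γ ℓ s) • v - inner ℝ v (tangent Γ ℓ s) • w)
        (by simp [hv, hw]) (by
          rw [inner_sub_left, real_inner_smul_left, real_inner_smul_left]
          ring)
      rw [inner_sub_left, real_inner_smul_left, real_inner_smul_left] at h0
      convert! h using 1
      linarith
    -- The contribution of the increment of I. Since Γ(q) ∧ Γ(r) = (Γ(q) - Γ(r)) ∧ Γ(r), it is O(|r
    -- - s| |F(r) - F(s)|), hence o(r - s) by mere continuity of F.
    let g : ℝ → ℝ := fun r =>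
      inner ℝ v (partialMean m Γ ℓ r - partialMean m Γ ℓ s) * inner ℝ w (Γ r) -
      inner ℝ w (partialMean m Γ ℓ r - partialMean m Γ ℓ s) * inner ℝ v (Γ r)
    have hbound : ∃ K, ∀ r ∈ Icc 0 ℓ,
        |g r| ≤ K * |(r - s) * (projCdf m Γ ℓ r - projCdf m Γ ℓ s)| := by
      obtain ⟨C, hC⟩ := isCompact_Icc.exists_bound_of_continuousOn hM.curve.continuousOn
      refine ⟨2 * (‖v‖ * ‖w‖ * C), fun r hr => ?_⟩
      have hg : g r = inner ℝ (inner ℝ w (Γ r) • v - inner ℝ v (Γ r) • w)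
          (partialMean m Γ ℓ r - partialMean m Γ ℓ s) := by
        simp only [g]
        rw [inner_sub_left, real_inner_smul_left, real_inner_smul_left]
        ring
      rw [hg, abs_mul, ← mul_assoc]
      refine hM.abs_inner_partialMean_sub_le_abs _ fun q hq hqr => ?_
      have hqr' : ‖Γ q - Γ r‖ ≤ |r - s| := by
        refine (hM.norm_sub_le hr hq).trans ?_
        rw [abs_sub_comm q r]
        exact abs_sub_right_of_mem_uIcc hqr
      have e : inner ℝ (inner ℝ w (Γ r) • v - inner ℝ v (Γ r) • w) (Γ q) =
          inner ℝ w (Γ r) * inner ℝ v (Γ q - Γ r) - inner ℝ v (Γ r) * inner ℝ w (Γ q - Γ r) := by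
        rw [inner_sub_left, real_inner_smul_left, real_inner_smul_left, inner_sub_right,
          inner_sub_right]
        ring
      have hb : ∀ a b : EuclideanSpace ℝ (Fin (n + 1)),
          |inner ℝ a (Γ r) * inner ℝ b (Γ q - Γ r)| ≤ ‖a‖ * ‖b‖ * C * |r - s| := by
        intro a b
        rw [abs_mul]
        have h1 : |inner ℝ a (Γ r)| ≤ ‖a‖ * C := (abs_real_inner_le_norm _ _).trans
          (mul_le_mul_of_nonneg_left (hC r hr) (norm_nonneg _))
        have h2 : |inner ℝ b (Γ q - Γ r)| ≤ ‖b‖ * |r - s| := (abs_real_inner_le_norm _ _).trans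
          (mul_le_mul_of_nonneg_left hqr' (norm_nonneg _))
        calc _ ≤ (‖a‖ * C) * (‖b‖ * |r - s|) :=
              mul_le_mul h1 h2 (abs_nonneg _) ((abs_nonneg _).trans h1)
          _ = _ := by ring
      rw [e]
      refine (abs_sub _ _).trans ?_
      have b1 := hb w v
      have b2 := hb v w
      linarith
    have h2 : HasDerivWithinAt g 0 (Icc 0 ℓ) s := by
      obtain ⟨K, hK⟩ := hbound
      rw [hasDerivWithinAt_iff_isLittleO]
      have hgs : g s = 0 := by simp [g]
      simp only [hgs, sub_zero, smul_zero]
      have hO : g =O[𝓝[Icc 0 ℓ] s] fun r => (r - s) * (projCdf m Γ ℓ r - projCdf m Γ ℓ s) :=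
        Asymptotics.IsBigO.of_bound K (by
          filter_upwards [self_mem_nhdsWithin] with r hr
          exact hK r hr)
      refine hO.trans_isLittleO ?_
      have ho : (fun r => projCdf m Γ ℓ r - projCdf m Γ ℓ s) =o[𝓝[Icc 0 ℓ] s]
          fun _ => (1 : ℝ) := by
        rw [Asymptotics.isLittleO_one_iff]
        have := ((hM.continuousAt_projCdf hs).tendsto.mono_left
          (nhdsWithin_le_nhds (s := Icc 0 ℓ))).sub_const (projCdf m Γ ℓ s)
        simpa using this
      simpa using (Asymptotics.isBigO_refl (fun r => r - s) (𝓝[Icc 0 ℓ] s)).mul_isLittleO ho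
    have h3 := h1.add h2
    rw [add_zero] at h3
    refine h3.congr_of_eventuallyEq (Eventually.of_forall fun r => ?_) ?_
    all_goals
      simp only [f, g, Pi.add_apply, inner_sub_right]
      ring
  have hconst := constant_of_derivWithin_zero
    (fun r hr => (hderiv r hr).differentiableWithinAt) (fun r hr =>
      (hderiv r (Ico_subset_Icc_self hr)).derivWithin
        (uniqueDiffOn_Icc hM.curve.length_pos r (Ico_subset_Icc_self hr))) s hs
  have h0 : f 0 = 0 := by simp [f, hM.partialMean_zero]
  exact hconst.trans h0

end SymmetricPrincipalLaw

/-! ### Propagating orthogonality along the curve -/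

theorem exists_horizontal_inner_eq_zero (hn : 2 ≤ n) (a : EuclideanSpace ℝ (Fin (n + 1))) :
    ∃ w : EuclideanSpace ℝ (Fin (n + 1)), w ≠ 0 ∧ w (Fin.last n) = 0 ∧ inner ℝ w a = 0 := by
  classical
  let K : Submodule ℝ (EuclideanSpace ℝ (Fin (n + 1))) :=
    Submodule.span ℝ (({EuclideanSpace.single (Fin.last n) 1, a} :
      Finset (EuclideanSpace ℝ (Fin (n + 1)))) : Set (EuclideanSpace ℝ (Fin (n + 1))))
  have hK : Kᗮ ≠ ⊥ := by
    intro h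
    have h1 : Module.finrank ℝ K ≤ 2 := (finrank_span_finset_le_card _).trans Finset.card_le_two
    rw [Submodule.orthogonal_eq_bot_iff.1 h, finrank_top, finrank_euclideanSpace_fin] at h1
    omega
  obtain ⟨w, hw, hw0⟩ := Submodule.exists_mem_ne_zero_of_ne_bot hK
  have h1 := hw (EuclideanSpace.single (Fin.last n) 1) (Submodule.subset_span (by simp))
  have h2 := hw a (Submodule.subset_span (by simp))
  refine ⟨w, hw0, ?_, by rwa [real_inner_comm]⟩
  simpa [EuclideanSpace.inner_single_left] using h1

namespace SymmetricPrincipalLaw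

/-- Let M be the maximum of |w · Γ| on a ball of radius ε < c. As the total mass is 1, |w · I| ≤ M,
so coercivity gives |w · Γ'| ≤ M/c. Integrating from s₀ yields M ≤ (ε/c)M, hence M = 0. -/
theorem eventually_inner_eq_zero (hn : 2 ≤ n) (hM : SymmetricPrincipalLaw m Γ ℓ)
    {w : EuclideanSpace ℝ (Fin (n + 1))} (hw : w (Fin.last n) = 0) {s₀ : ℝ}
    (hs₀ : s₀ ∈ Ioo 0 ℓ) (hΓ₀ : inner ℝ w (Γ s₀) = 0)
    (hI₀ : inner ℝ w (partialMean m Γ ℓ s₀) = 0) :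
    ∀ᶠ s in 𝓝 s₀, inner ℝ w (Γ s) = 0 ∧ inner ℝ w (partialMean m Γ ℓ s) = 0 := by
  obtain ⟨c, hc, hev⟩ := hM.exists_abs_inner_tangent_le hn hs₀
  obtain ⟨r, hr, hball⟩ := Metric.eventually_nhds_iff_ball.1
    (hev.and (Ioo_mem_nhds hs₀.1 hs₀.2))
  obtain ⟨ε, hε, hεr, hεc⟩ : ∃ ε > 0, ε < r ∧ ε < c :=
    ⟨min r c / 2, by positivity, (half_lt_self (by positivity)).trans_le (min_le_left _ _),
      (half_lt_self (by positivity)).trans_le (min_le_right _ _)⟩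
  set K := Metric.closedBall s₀ ε with hK
  have hKball : ∀ s ∈ K, s ∈ Metric.ball s₀ r := fun s hs =>
    Metric.closedBall_subset_ball hεr hs
  have hKI : K ⊆ Icc 0 ℓ := fun s hs => Ioo_subset_Icc_self (hball s (hKball s hs)).2
  have hs₀K : s₀ ∈ K := Metric.mem_closedBall_self hε.le
  have hKconv : Convex ℝ K := convex_closedBall _ _
  obtain ⟨t, ht, hmax⟩ := (isCompact_closedBall s₀ ε).exists_isMaxOn ⟨s₀, hs₀K⟩
    ((continuousOn_const.inner (hM.curve.continuousOn.mono hKI)).abs :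
      ContinuousOn (fun s => |(inner ℝ w (Γ s) : ℝ)|) K)
  set M := |(inner ℝ w (Γ t) : ℝ)| with hMdef
  have hle : ∀ s ∈ K, |(inner ℝ w (Γ s) : ℝ)| ≤ M := fun s hs => hmax hs
  have hI : ∀ s ∈ K, |inner ℝ w (partialMean m Γ ℓ s)| ≤ M := by
    intro s hs
    have h1 := hM.abs_inner_partialMean_sub_le_abs (s := s₀) (s' := s) w
      (fun q _ hq => hle q (hKconv.ordConnected.uIcc_subset hs₀K hs hq))
    rw [inner_sub_right, hI₀, sub_zero] at h1
    refine h1.trans (mul_le_of_le_one_right (abs_nonneg _) (abs_le.2 ⟨?_, ?_⟩))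
    · linarith [hM.projCdf_sub_le_one s s₀]
    · exact hM.projCdf_sub_le_one s₀ s
  have hderiv : ∀ s ∈ K, HasDerivWithinAt (fun s => (inner ℝ w (Γ s) : ℝ))
      (inner ℝ w (tangent Γ ℓ s)) K s := fun s hs => by
    simpa using (hasDerivWithinAt_const s K w).inner ℝ
      ((hM.curve.hasDerivWithinAt (hKI hs)).mono hKI)
  have hbound : ∀ s ∈ K, ‖(inner ℝ w (tangent Γ ℓ s) : ℝ)‖ ≤ M / c := by
    intro s hs
    rw [le_div_iff₀ hc, mul_comm]
    exact ((hball s (hKball s hs)).1 w hw).trans (hI s hs)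
  have hM0 : M = 0 := by
    have h1 := hKconv.norm_image_sub_le_of_norm_hasDerivWithin_le hderiv hbound hs₀K ht
    rw [hΓ₀, sub_zero] at h1
    have h2 : M ≤ M / c * ε := h1.trans (mul_le_mul_of_nonneg_left
      (by simpa [dist_eq_norm] using Metric.mem_closedBall.1 ht) (by positivity))
    rw [div_mul_eq_mul_div, le_div_iff₀ hc] at h2
    have h3 : 0 ≤ M := abs_nonneg _
    nlinarith
  filter_upwards [Metric.closedBall_mem_nhds s₀ hε] with s hs
  exact ⟨abs_nonpos_iff.1 (hM0 ▸ hle s hs), abs_nonpos_iff.1 (hM0 ▸ hI s hs)⟩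

theorem exists_inner_eq_zero (hn : 2 ≤ n) (hM : SymmetricPrincipalLaw m Γ ℓ) :
    ∃ w : EuclideanSpace ℝ (Fin (n + 1)), w ≠ 0 ∧ ∀ s ∈ Icc 0 ℓ, inner ℝ w (Γ s) = 0 := by
  have hℓ := hM.curve.length_pos
  have hmid : ℓ / 2 ∈ Ioo 0 ℓ := ⟨by linarith, by linarith⟩
  obtain ⟨w, hw0, hw, hΓw, hIw⟩ : ∃ w : EuclideanSpace ℝ (Fin (n + 1)), w ≠ 0 ∧
      w (Fin.last n) = 0 ∧ inner ℝ w (Γ (ℓ / 2)) = 0 ∧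
      inner ℝ w (partialMean m Γ ℓ (ℓ / 2)) = 0 := by
    set a := horizontal (Γ (ℓ / 2)) with ha
    -- If Γ at the midpoint lies on the axis, only I imposes a condition on w. Otherwise the wedge
    -- identity makes the horizontal part of I a multiple of a, so orthogonality to Γ suffices.
    by_cases h0 : a = 0
    · obtain ⟨w, hw0, hw, hwI⟩ :=
        exists_horizontal_inner_eq_zero hn (partialMean m Γ ℓ (ℓ / 2))
      exact ⟨w, hw0, hw, by rw [← inner_horizontal hw, ← ha, h0, inner_zero_right], hwI⟩
    · obtain ⟨w, hw0, hw, hwa⟩ := exists_horizontal_inner_eq_zero hn (Γ (ℓ / 2))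
      refine ⟨w, hw0, hw, hwa, ?_⟩
      have h := hM.wedge_partialMean_eq_zero (horizontal_last (Γ (ℓ / 2))) hw
        (Ioo_subset_Icc_self hmid)
      rw [hwa, mul_zero, zero_sub, neg_eq_zero, inner_horizontal_self, ← ha] at h
      exact (mul_eq_zero.1 h).resolve_right (by positivity)
  refine ⟨w, hw0, ?_⟩
  have hcΓ : ContinuousOn (fun s => (inner ℝ w (Γ s) : ℝ)) (Icc 0 ℓ) :=
    continuousOn_const.inner hM.curve.continuousOn
  have hcI := hM.continuousOn_inner_partialMean w
  set u := {s | s ∈ Ioo 0 ℓ ∧ inner ℝ w (Γ s) = 0 ∧ inner ℝ w (partialMean m Γ ℓ s) = 0} with hu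
  have huo : IsOpen u := by
    rw [isOpen_iff_mem_nhds]
    rintro s ⟨hs, h1, h2⟩
    exact inter_mem (Ioo_mem_nhds hs.1 hs.2) (hM.eventually_inner_eq_zero hn hw hs h1 h2)
  -- The set u is open by propagation and relatively closed by continuity of w · Γ and w · I.
  have hsub : Ioo 0 ℓ ⊆ u := by
    refine isPreconnected_Ioo.subset_of_closure_inter_subset huo
      ⟨ℓ / 2, hmid, hmid, hΓw, hIw⟩ fun s hs => ⟨hs.2, ?_, ?_⟩
    all_goals
      have hsI := Icc_mem_nhds hs.2.1 hs.2.2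
    · have := (hcΓ.continuousAt hsI).continuousWithinAt (s := u) |>.mem_closure_image hs.1
      have himg : (fun s => (inner ℝ w (Γ s) : ℝ)) '' u ⊆ {0} := by
        rintro _ ⟨r, hr, rfl⟩
        exact hr.2.1
      simpa using closure_mono himg this
    · have := (hcI.continuousAt hsI).continuousWithinAt (s := u) |>.mem_closure_image hs.1
      have himg : (fun s => (inner ℝ w (partialMean m Γ ℓ s) : ℝ)) '' u ⊆ {0} := by
        rintro _ ⟨r, hr, rfl⟩
        exact hr.2.2
      simpa using closure_mono himg this
  intro s hs
  have hcl : s ∈ closure (Ioo 0 ℓ) := by rwa [closure_Ioo hℓ.ne]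
  have := ((hcΓ s hs).mono Ioo_subset_Icc_self).mem_closure_image hcl
  have himg : (fun s => (inner ℝ w (Γ s) : ℝ)) '' Ioo 0 ℓ ⊆ {0} := by
    rintro _ ⟨r, hr, rfl⟩
    exact (hsub hr).2.1
  simpa using closure_mono himg this

end SymmetricPrincipalLaw

end PrincipalCurve

theorem mainTheorem4 {Ω : Type*} [MeasurableSpace Ω] (P : Measure Ω) [IsProbabilityMeasure P]
    (n : ℕ) (hn : 2 ≤ n)
    (𝕏 : Set (EuclideanSpace ℝ (Fin (n + 1)))) (h𝕏 : PrincipalCurve.IsCompactRegion 𝕏)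
    (p : EuclideanSpace ℝ (Fin (n + 1)) → ℝ) (hp : PrincipalCurve.IsSmoothDensityOn p 𝕏)
    (hsym : PrincipalCurve.RotationallySymmetric p)
    (X : Ω → EuclideanSpace ℝ (Fin (n + 1))) (hX : PrincipalCurve.HasDensity P X p)
    (Γ : ℝ → EuclideanSpace ℝ (Fin (n + 1))) (ℓ : ℝ)
    (hΓ : PrincipalCurve.IsPrincipalCurve P X Γ ℓ)
    (hadm : PrincipalCurve.IsAdmissible 𝕏 Γ ℓ)
    (hstart : Γ 0 ∈ frontier 𝕏) :
    ∃ H : AffineSubspace ℝ (EuclideanSpace ℝ (Fin (n + 1))),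
      Module.finrank ℝ H.direction = n ∧ ∀ s ∈ Icc 0 ℓ, Γ s ∈ H := by
  have hM := PrincipalCurve.symmetricPrincipalLaw h𝕏 hp hsym hX hΓ hadm
  obtain ⟨w, hw0, hw⟩ := hM.exists_inner_eq_zero hn
  refine ⟨AffineSubspace.mk' 0 (ℝ ∙ w)ᗮ, ?_, fun s hs => ?_⟩
  · rw [AffineSubspace.direction_mk']
    have : Fact (Module.finrank ℝ (EuclideanSpace ℝ (Fin (n + 1))) = n + 1) := ⟨by simp⟩
    exact Submodule.finrank_orthogonal_span_singleton hw0
  · rw [AffineSubspace.mem_mk', vsub_eq_sub, sub_zero,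
      Submodule.mem_orthogonal_singleton_iff_inner_right]
    exact hw s hs
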